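/- Let $G$ be a complex semisimple (or, more generally, reductive) linear algebraic group, $T\subseteq B\subseteq P$ a maximal torus, a Borel subgroup and a parabolic subgroup, with roots $\Delta\subset\mathfrak t^*$, positive roots $\Delta^+$, simple roots $\alpha_1,\dots,\alpha_n$, Weyl group $W$, and $W_J=\langle s_j: j\in J\rangle$ the subgroup of $W$ defined by $P$. Write $[w]$ for the coset $wW_J\in W/W_J$, and $\Delta_{\mathfrak n^-}$ for the set of roots whose root space is not contained in $\mathrm{Lie}(P)$, i.e. the negative roots not in $\mathbb Z\{\alpha_j:j\in J\}$. The moment graph of $G/P$ has vertex set $W/W_J$ and a directed edge $[w]\stackrel{\alpha}{\mapsto}[s_\alpha w]$ for each $\alpha\in\Delta^+$ with $w^{-1}(\alpha)\in\Delta_{\mathfrak n^-}$. In the GKM presentation, with coordinatewise operations, $$H^*_T(G/P)=\{p:W/W_J\to S(\mathfrak t^*)\ :\ p([w])-p([v])\in(\alpha)\text{ for every edge }[w]\stackrel{\alpha}{\mapsto}[v]\}.$$ The group $W$ acts on functions $p: W/W_J\to S(\mathfrak t^*)$ by $(w\cdot p)([v])=w\,\bigl(p([w^{-1}v])\bigr)$.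 A flow-up class for $[v]$ is a class $p\in H^*_T(G/P)$ that is homogeneous, satisfies $p([u])\ne0$ if and only if there is a (possibly empty) directed path from $[u]$ to $[v]$ in the moment graph, and satisfies $p([v])=\prod\alpha$, the product over the labels $\alpha$ of the edges directed out of $[v]$. For each $[v]$ there is exactly one flow-up class $p_{[v]}$, and these classes form a basis of the $S(\mathfrak t^*)$-module $H^*_T(G/P)$. Let $<_P$ be the strict Bruhat order on $W/W_J$, i.e. the Bruhat order on minimal-length coset representatives. For each simple reflection $s_i$ let $\partial_i f=(f-s_if)/\alpha_i$ for $f\in S(\mathfrak t^*)$, the Bernstein--Gelfand--Gelfand divided difference operator. Then $$\delta_i p=\frac{p-s_i\cdot p}{\alpha_i}$$ is a well-defined $\mathbb C$-linear operator $H^*_T(G/P)\to H^*_T(G/P)$, and $\delta_i^2=0$. For all $c\in S(\mathfrak t^*)$ and $p\in H^*_T(G/P)$, $\delta_i(cp)=(\partial_i c)\,p+(s_ic)\,\delta_ip$. For every $[v]\in W/W_J$, $\delta_i p_{[v]}=p_{[s_iv]}$ if $[s_iv]<_P[v]$, and $\delta_i p_{[v]}=0$ otherwise. -/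

import Mathlib

noncomputable section

namespace PartialFlag

variable {ι M N : Type*} [Finite ι] [AddCommGroup M] [Module ℂ M] [AddCommGroup N] [Module ℂ N]
  {P : RootPairing ι ℂ M N} (b : P.Base)

/-! ### Length and Bruhat order on the Weyl group -/

/-- The product `s_{i₁} ⋯ s_{iₖ}` of a word in the simple reflections. -/
def wordProd (l : List b.support) : P.weylGroup :=
  (l.map fun i => RootPairing.weylGroup.ofIdx P (i : ι)).prod

/-- The length of `w`: the least number of simple reflections in a factorization of `w`. -/
def length (w : P.weylGroup) : ℕ :=
  sInf {k | ∃ l : List b.support, wordProd b l = w ∧ l.length = k}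

/-- The word `l` is a minimal-length factorization of `w` into simple reflections. -/
def IsReducedWord (l : List b.support) (w : P.weylGroup) : Prop :=
  wordProd b l = w ∧ l.length = length b w

/-- Bruhat order: `v ≤ w` if some reduced word of `w` has a subword with product `v`. -/
def BruhatLE (v w : P.weylGroup) : Prop :=
  ∃ l : List b.support, IsReducedWord b l w ∧
    ∃ l' : List b.support, l'.Sublist l ∧ wordProd b l' = v

/-! ### The cosets `W / W_J` -/

variable (J : Set b.support)

/-- The parabolic subgroup `W_J` generated by the simple reflections in `J`. -/
def parabolic : Subgroup P.weylGroup :=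
  Subgroup.closure ((fun j : b.support => RootPairing.weylGroup.ofIdx P (j : ι)) '' J)

/-- The set `W / W_J` of left cosets; `W` acts on it by left multiplication. -/
abbrev Cosets : Type _ := P.weylGroup ⧸ parabolic b J

/-- `w` is a minimal-length representative of the coset `x`. -/
def IsMinRep (w : P.weylGroup) (x : Cosets b J) : Prop :=
  (w : Cosets b J) = x ∧ ∀ u : P.weylGroup, (u : Cosets b J) = x → length b w ≤ length b u

/-- Bruhat order on `W / W_J`: the Bruhat order on minimal-length representatives. -/
def CosetLE (x y : Cosets b J) : Prop :=
  ∃ v w : P.weylGroup, IsMinRep b J v x ∧ IsMinRep b J w y ∧ BruhatLE b v w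

/-- The strict order on `W / W_J`. -/
def CosetLT (x y : Cosets b J) : Prop :=
  CosetLE b J x y ∧ x ≠ y

/-! ### The moment graph of `G/P` -/

/-- The roots of the Levi part: those in the `ℤ`-span of the simple roots in `J`. -/
def IsLeviRoot (α : ι) : Prop :=
  P.root α ∈ Submodule.span ℤ ((fun j : b.support => P.root (j : ι)) '' J)

/-- The roots whose root space is not contained in the Lie algebra of the parabolic subgroup,
that is, the roots that are neither positive nor roots of the Levi part. -/
def IsNilMinus (α : ι) : Prop :=
  ¬ b.IsPos α ∧ ¬ IsLeviRoot b J α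

/-- The moment graph has an edge directed from `x` to `y` and labeled by the positive root `α`:
`x = [w]`, `y = [s_α w] ≠ [w]`, and `w⁻¹(α)` is a root not occurring in the parabolic
(hence negative). -/
def Edge (x : Cosets b J) (α : ι) (y : Cosets b J) : Prop :=
  b.IsPos α ∧ x ≠ y ∧ ∃ w : P.weylGroup, (w : Cosets b J) = x ∧
    ((RootPairing.weylGroup.ofIdx P α * w : P.weylGroup) : Cosets b J) = y ∧
    IsNilMinus b J (P.weylGroupToPerm w⁻¹ α)

/-- The partial order of the moment graph: `y ≤ x` if a sequence of directed edges leads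
from `x` to `y`. -/
def GraphLE (y x : Cosets b J) : Prop :=
  Relation.ReflTransGen (fun x' y' => ∃ α, Edge b J x' α y') x y

/-! ### The symmetric algebra and the Weyl group action on it -/

/-- The root `α` as an element of the symmetric algebra. -/
def rootS (P : RootPairing ι ℂ M N) (α : ι) : SymmetricAlgebra ℂ M :=
  SymmetricAlgebra.ι ℂ M (P.root α)

/-- The action of `w` on the symmetric algebra by `ℂ`-algebra homomorphisms, extending the
action on the degree one part. -/
def actS (w : P.weylGroup) : SymmetricAlgebra ℂ M →ₐ[ℂ] SymmetricAlgebra ℂ M :=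
  SymmetricAlgebra.lift (SymmetricAlgebra.ι ℂ M ∘ₗ P.weylGroupRootRep w)

/-- The homogeneous elements of degree `d` in the symmetric algebra. -/
def homogeneousS (M : Type*) [AddCommGroup M] [Module ℂ M] (d : ℕ) :
    Submodule ℂ (SymmetricAlgebra ℂ M) :=
  LinearMap.range (SymmetricAlgebra.ι ℂ M) ^ d

/-! ### Equivariant cohomology in the GKM presentation -/

/-- The GKM presentation of `H^*_T(G/P)`: the functions from `W / W_J` to the symmetric algebra
whose values at the ends of an edge labeled `α` differ by an element of the ideal `(α)`, with
coordinatewise operations. -/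
def GKM : Subalgebra (SymmetricAlgebra ℂ M) (Cosets b J → SymmetricAlgebra ℂ M) where
  carrier := {p | ∀ x α y, Edge b J x α y → p x - p y ∈ Ideal.span {rootS P α}}
  mul_mem' := by
    intro p q hp hq x α y h
    have e : (p * q) x - (p * q) y = p x * (q x - q y) + q y * (p x - p y) := by
      simp only [Pi.mul_apply]; ring
    rw [e]
    exact add_mem (Ideal.mul_mem_left _ _ (hq x α y h)) (Ideal.mul_mem_left _ _ (hp x α y h))
  add_mem' := by
    intro p q hp hq x α y h
    have e : (p + q) x - (p + q) y = (p x - p y) + (q x - q y) := by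
      simp only [Pi.add_apply]; ring
    rw [e]
    exact add_mem (hp x α y h) (hq x α y h)
  algebraMap_mem' := by
    intro c x α y _
    simp

/-- The action of `w` on functions: `(w · p)([v]) = w (p (w⁻¹ [v]))`. -/
def actFun {b : P.Base} {J : Set b.support} (w : P.weylGroup)
    (p : Cosets b J → SymmetricAlgebra ℂ M) :
    Cosets b J → SymmetricAlgebra ℂ M :=
  fun x => actS w (p (w⁻¹ • x))

/-- `p` is a flow-up class for the vertex `x`: it is supported exactly on the vertices `y ≥ x`,
it is homogeneous, and its value at `x` is the product of the labels of the edges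
directed out of `x`. -/
structure IsFlowUp (x : Cosets b J) (p : GKM b J) : Prop where
  support : ∀ y, p.1 y ≠ 0 ↔ GraphLE b J x y
  homogeneous : ∃ d, ∀ y, p.1 y ∈ homogeneousS M d
  localization : p.1 x = ∏ᶠ α ∈ {α : ι | ∃ y, Edge b J x α y}, rootS P α

end PartialFlag

end

/-! ### Root combinatorics of the Weyl group and of its parabolic subgroup. -/

noncomputable section

open RootPairing
open scoped Classical

namespace PartialFlag

variable {ι M N : Type*} [Finite ι] [AddCommGroup M] [Module ℂ M] [AddCommGroup N] [Module ℂ N]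
  {P : RootPairing ι ℂ M N} (b : P.Base)

/-! ### Reflections in the Weyl group -/

/-! Let rk(x) be the number of edges leaving x. As s_i permutes the positive roots other than α_i,
whenever α_i is a label at x the labels at s_i x are the s_i-images of the other labels at x, so rk
drops by exactly one. If α_i is a label at neither x nor s_i x, then s_i x = x.

The proof works with `IsSchubert`: degree rk(v), the prescribed value at v, and otherwise support
only where rk exceeds rk(v). Since δ_i lowers degrees by one, it carries such a class for v to one
for s_i v when α_i is a label at v (`IsSchubert.leftDiv`). The key bound is `exists_rk_le`: at a
lowest vertex of the support of a class all outgoing labels divide the value, and they are pairwise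
non-associated primes, so a nonzero class of degree d is nonzero somewhere with rk ≤ d. This gives
uniqueness, and δ_i p_v = 0 when α_i is not a label at v. Existence starts at a vertex that no edge
enters and descends by the δ_i. By `cosetLT_smul_iff`, α_i is a label at v exactly when s_i v < v in
Bruhat order.

The exact support comes from the same bound in one direction and from positivity in the other: q(w)
= s_i(q(s_i w)) + α_i s_i((δ_i q)(s_i w)) unfolds without cancellation, and `GraphLE.lifting` keeps
some term nonzero. So these classes are the flow-up classes, edges lower rk, and triangularity gives
the basis. -/

omit [Finite ι] in
lemma weylGroup_ext {w w' : P.weylGroup} (h : ∀ m : M, w • m = w' • m) : w = w' :=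
  Subtype.ext (Equiv.weightHom_injective P (LinearEquiv.ext h))

omit [Finite ι] in
lemma root_perm (w : P.weylGroup) (α : ι) :
    P.root (P.weylGroupToPerm w α) = w • P.root α :=
  (weylGroup_apply_root P w α).symm

omit [Finite ι] in
lemma perm_mul (w w' : P.weylGroup) (α : ι) :
    P.weylGroupToPerm (w * w') α = P.weylGroupToPerm w (P.weylGroupToPerm w' α) := by
  rw [map_mul]; rfl

omit [Finite ι] in
lemma perm_inv_perm (w : P.weylGroup) (α : ι) :
    P.weylGroupToPerm w⁻¹ (P.weylGroupToPerm w α) = α := by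
  rw [← perm_mul]; simp

omit [Finite ι] in
lemma perm_perm_inv (w : P.weylGroup) (α : ι) :
    P.weylGroupToPerm w (P.weylGroupToPerm w⁻¹ α) = α := by
  rw [← perm_mul]; simp

omit [Finite ι] in
lemma perm_ofIdx (α β : ι) :
    P.weylGroupToPerm (weylGroup.ofIdx P α) β = P.reflectionPerm α β := rfl

omit [Finite ι] in
lemma ofIdx_smul_eq (α : ι) (m : M) : weylGroup.ofIdx P α • m = P.reflection α m := rfl

omit [Finite ι] in
lemma ofIdx_mul_self (α : ι) : weylGroup.ofIdx P α * weylGroup.ofIdx P α = 1 :=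
  weylGroup_ext fun m => by simp [mul_smul]

omit [Finite ι] in
lemma ofIdx_inv (α : ι) : (weylGroup.ofIdx P α)⁻¹ = weylGroup.ofIdx P α :=
  inv_eq_of_mul_eq_one_left (ofIdx_mul_self α)

omit [Finite ι] in
lemma ofIdx_conj (w : P.weylGroup) (α : ι) :
    w * weylGroup.ofIdx P α * w⁻¹ = weylGroup.ofIdx P (P.weylGroupToPerm w α) := by
  obtain ⟨g, hg⟩ := w
  induction hg using weylGroup.induction generalizing α with
  | mem i =>
    change weylGroup.ofIdx P i * _ * (weylGroup.ofIdx P i)⁻¹ =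
      weylGroup.ofIdx P (P.reflectionPerm i α)
    refine weylGroup_ext fun m => ?_
    rw [ofIdx_inv]
    simp only [mul_smul, ofIdx_smul_eq, reflection_reflectionPerm]
    rfl
  | one =>
    have : (⟨1, one_mem _⟩ : P.weylGroup) = 1 := rfl
    rw [this]; simp
  | mul x y hx hy ihx ihy =>
    have : (⟨x * y, mul_mem hx hy⟩ : P.weylGroup) = ⟨x, hx⟩ * ⟨y, hy⟩ := rfl
    rw [this, perm_mul, ← ihx, ← ihy]
    group

omit [Finite ι] in
lemma ofIdx_mul_eq (w : P.weylGroup) (α : ι) :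
    weylGroup.ofIdx P α * w = w * weylGroup.ofIdx P (P.weylGroupToPerm w⁻¹ α) := by
  rw [← ofIdx_conj]; group

omit [Finite ι] in
lemma perm_ofIdx_mul_inv_self (w : P.weylGroup) (α : ι) :
    P.weylGroupToPerm (weylGroup.ofIdx P α * w)⁻¹ α =
      P.reflectionPerm (P.weylGroupToPerm w⁻¹ α) (P.weylGroupToPerm w⁻¹ α) := by
  rw [← perm_ofIdx, ← ofIdx_conj, ← perm_mul]; simp [ofIdx_inv]

omit [Finite ι] in
lemma ofIdx_reflectionPerm_self (α : ι) :
    weylGroup.ofIdx P (P.reflectionPerm α α) = weylGroup.ofIdx P α := by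
  rw [← perm_ofIdx, ← ofIdx_conj]; simp

/-! ### Coefficients of roots -/

/-- The coefficient of the simple root `k` in the root `α`. -/
def coeff (k : b.support) (α : ι) : ℤ := (b.exists_root_eq_sum_int α).choose k

omit [Finite ι] in
lemma root_eq_sum (α : ι) : P.root α = ∑ k : b.support, coeff b k α • P.root (k : ι) := by
  obtain ⟨-, -, h⟩ := (b.exists_root_eq_sum_int α).choose_spec
  rw [← Finset.sum_coe_sort] at h
  exact h

omit [Finite ι] in
lemma coeff_eq_of_sum {α : ι} {f : b.support → ℤ}
    (h : P.root α = ∑ k : b.support, f k • P.root (k : ι)) (k : b.support) :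
    coeff b k α = f k :=
  Fintype.linearIndependent_iffₛ.mp (b.linearIndepOn_root.restrict_scalars' ℤ)
    (fun k => coeff b k α) f ((root_eq_sum b α).symm.trans h) k

omit [Finite ι] in
lemma height_eq (α : ι) : b.height α = ∑ k : b.support, coeff b k α := by
  rw [Base.height, ← Finset.sum_coe_sort]; rfl

omit [Finite ι] in
lemma coeff_nonneg_or_nonpos (α : ι) : (∀ k, 0 ≤ coeff b k α) ∨ ∀ k, coeff b k α ≤ 0 := by
  obtain ⟨-, h | h, -⟩ := (b.exists_root_eq_sum_int α).choose_spec
  · exact .inl fun k => h.le k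
  · exact .inr fun k => h.le k

omit [Finite ι] in
lemma isPos_iff_coeff {α : ι} : b.IsPos α ↔ ∀ k, 0 ≤ coeff b k α := by
  constructor
  · intro h
    refine (coeff_nonneg_or_nonpos b α).resolve_right fun h' => ?_
    rw [b.isPos_iff, height_eq] at h
    exact absurd (Finset.sum_nonpos fun k _ => h' k) (not_le.2 h)
  · intro h
    rw [b.isPos_iff', height_eq]
    exact Finset.sum_nonneg fun k _ => h k

omit [Finite ι] in
lemma not_isPos_iff_coeff {α : ι} : ¬ b.IsPos α ↔ ∀ k, coeff b k α ≤ 0 := by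
  constructor
  · intro h
    exact (coeff_nonneg_or_nonpos b α).resolve_left fun h' => h ((isPos_iff_coeff b).2 h')
  · intro h h'
    rw [b.isPos_iff, height_eq] at h'
    exact absurd (Finset.sum_nonpos fun k _ => h k) (not_le.2 h')

omit [Finite ι] in
lemma not_isPos_of_coeff_neg {α : ι} {k : b.support} (h : coeff b k α < 0) : ¬ b.IsPos α :=
  fun h' => absurd ((isPos_iff_coeff b).1 h' k) (not_le.2 h)

omit [Finite ι] in
lemma isPos_simple (i : b.support) : b.IsPos i := Base.isPos_of_mem_support i.2

omit [Finite ι] in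
lemma coeff_reflectionPerm_self (k : b.support) (α : ι) :
    coeff b k (P.reflectionPerm α α) = -coeff b k α := by
  refine coeff_eq_of_sum b (f := fun k => -coeff b k α) ?_ k
  simp only [neg_smul, Finset.sum_neg_distrib, ← root_eq_sum, root_reflectionPerm,
    reflection_apply_self]

omit [Finite ι] in
lemma isPos_reflectionPerm_self {α : ι} : b.IsPos (P.reflectionPerm α α) ↔ ¬ b.IsPos α := by
  rw [isPos_iff_coeff, not_isPos_iff_coeff]
  simp [coeff_reflectionPerm_self]

omit [Finite ι] in
lemma coeff_perm (w : P.weylGroup) (k : b.support) (α : ι) :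
    coeff b k (P.weylGroupToPerm w α) =
      ∑ l : b.support, coeff b l α * coeff b k (P.weylGroupToPerm w l) := by
  refine coeff_eq_of_sum b
    (f := fun k => ∑ l : b.support, coeff b l α * coeff b k (P.weylGroupToPerm w l)) ?_ k
  simp_rw [Finset.sum_smul]
  rw [Finset.sum_comm, root_perm, root_eq_sum b α, Finset.smul_sum]
  refine Finset.sum_congr rfl fun l _ => ?_
  simp_rw [mul_smul]
  rw [← Finset.smul_sum, ← root_eq_sum, root_perm, smul_comm]

section Crystallographic

variable [P.IsCrystallographic]

omit [Finite ι] in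
lemma coeff_reflectionPerm (i k : b.support) (α : ι) :
    coeff b k (P.reflectionPerm i α) =
      coeff b k α - P.pairingIn ℤ α i * (if k = i then 1 else 0) := by
  refine coeff_eq_of_sum b
    (f := fun k => coeff b k α - P.pairingIn ℤ α i * (if k = i then 1 else 0)) ?_ k
  simp only [sub_smul, Finset.sum_sub_distrib, ← root_eq_sum, mul_smul, ← Finset.smul_sum]
  rw [root_reflectionPerm, reflection_apply_root' ℤ]
  congr 2
  simp [ite_smul]

variable [P.IsReduced]

lemma isPos_reflectionPerm {α : ι} (hα : b.IsPos α) (i : b.support) (h : α ≠ i) :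
    b.IsPos (P.reflectionPerm i α) :=
  hα.reflectionPerm i.2 h

end Crystallographic

/-! ### Levi roots -/

variable (J : Set b.support)

omit [Finite ι] in
lemma isLeviRoot_iff {α : ι} : IsLeviRoot b J α ↔ ∀ k ∉ J, coeff b k α = 0 := by
  constructor
  · intro h
    have key : ∀ x ∈ Submodule.span ℤ ((fun j : b.support => P.root (j : ι)) '' J),
        ∃ c : b.support → ℤ, (∀ k ∉ J, c k = 0) ∧ x = ∑ k, c k • P.root (k : ι) := by
      intro x hx
      induction hx using Submodule.span_induction with
      | mem x hx =>
        obtain ⟨j, hj, rfl⟩ := hx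
        refine ⟨fun k => if k = j then 1 else 0, fun k hk => ?_, by simp [ite_smul]⟩
        exact if_neg fun h : k = j => hk (h ▸ hj)
      | zero => exact ⟨0, by simp, by simp⟩
      | add x y _ _ hx hy =>
        obtain ⟨c, hc, rfl⟩ := hx
        obtain ⟨d, hd, rfl⟩ := hy
        exact ⟨c + d, fun k hk => by simp [hc k hk, hd k hk],
          by simp [add_smul, Finset.sum_add_distrib]⟩
      | smul z x _ hx =>
        obtain ⟨c, hc, rfl⟩ := hx
        exact ⟨z • c, fun k hk => by simp [hc k hk], by simp [mul_smul, Finset.smul_sum]⟩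
    obtain ⟨c, hc, hx⟩ := key _ h
    intro k hk
    rw [coeff_eq_of_sum b hx, hc k hk]
  · intro h
    rw [IsLeviRoot, root_eq_sum b α]
    refine Submodule.sum_mem _ fun k _ => ?_
    by_cases hk : k ∈ J
    · exact Submodule.smul_mem _ _ (Submodule.subset_span ⟨k, hk, rfl⟩)
    · rw [h k hk, zero_smul]; exact Submodule.zero_mem _

-- All coefficients of a root have the same sign, so one negative coefficient outside J witnesses
-- both conditions.
omit [Finite ι] in
lemma isNilMinus_iff {α : ι} : IsNilMinus b J α ↔ ∃ k ∉ J, coeff b k α < 0 := by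
  rw [IsNilMinus, isLeviRoot_iff]
  constructor
  · rintro ⟨h, h'⟩
    push Not at h'
    obtain ⟨k, hk, h'⟩ := h'
    exact ⟨k, hk, lt_of_le_of_ne ((not_isPos_iff_coeff b).1 h k) h'⟩
  · rintro ⟨k, hk, h⟩
    exact ⟨not_isPos_of_coeff_neg b h, fun h' => h.ne (h' k hk)⟩

variable [P.IsCrystallographic]

-- A simple reflection s_j changes only the α_j-coefficient. This makes the edge condition
-- independent of the coset representative.
omit [Finite ι] in
lemma coeff_perm_of_mem_parabolic {u : P.weylGroup} (hu : u ∈ parabolic b J) {k : b.support}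
    (hk : k ∉ J) (α : ι) : coeff b k (P.weylGroupToPerm u α) = coeff b k α := by
  induction hu using Subgroup.closure_induction generalizing α with
  | mem u hu =>
    obtain ⟨j, hj, rfl⟩ := hu
    rw [perm_ofIdx, coeff_reflectionPerm, if_neg fun h : k = j => hk (h ▸ hj)]
    simp
  | one => simp
  | mul x y _ _ hx hy => rw [perm_mul, hx, hy]
  | inv x _ hx => rw [← hx, perm_perm_inv]

omit [Finite ι] in
lemma ofIdx_notMem_parabolic {α : ι} {k : b.support} (hk : k ∉ J) (h : coeff b k α ≠ 0) :
    weylGroup.ofIdx P α ∉ parabolic b J := by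
  intro hu
  have := coeff_perm_of_mem_parabolic b J hu hk α
  rw [perm_ofIdx, coeff_reflectionPerm_self] at this
  lia

omit [Finite ι] in
lemma isNilMinus_perm {u : P.weylGroup} (hu : u ∈ parabolic b J) {α : ι} :
    IsNilMinus b J (P.weylGroupToPerm u α) ↔ IsNilMinus b J α := by
  simp only [isNilMinus_iff]
  refine exists_congr fun k => and_congr_right fun hk => ?_
  rw [coeff_perm_of_mem_parabolic b J hu hk]

variable [P.IsReduced]

/-- Induction on height: a positive root pairs positively with some simple α_j, and conjugating by
s_j lowers the height unless α = α_j. -/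
lemma ofIdx_mem_parabolic {α : ι} (h : ∀ k ∉ J, coeff b k α = 0) :
    weylGroup.ofIdx P α ∈ parabolic b J := by
  wlog hpos : b.IsPos α generalizing α
  · rw [← ofIdx_reflectionPerm_self]
    refine this (fun k hk => ?_) ((isPos_reflectionPerm_self b).2 hpos)
    rw [coeff_reflectionPerm_self, h k hk, neg_zero]
  generalize hN : (b.height α).toNat = n
  induction n using Nat.strong_induction_on generalizing α with
  | _ n ih =>
    obtain ⟨j, hj, hj'⟩ := hpos.exists_mem_support_pos_pairingIn
    rw [P.zero_lt_pairingIn_iff'] at hj'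
    obtain ⟨j, rfl⟩ : ∃ j' : b.support, (j' : ι) = j := ⟨⟨j, hj⟩, rfl⟩
    -- For j outside J, distinct simple roots pair nonpositively, so a nonnegative combination of
    -- the α_k with k ∈ J could not pair positively with α_j.
    have hjJ : j ∈ J := by
      by_contra hjJ
      have e : P.pairingIn ℤ α j = ∑ k : b.support, coeff b k α * P.pairingIn ℤ k j :=
        FaithfulSMul.algebraMap_injective ℤ ℂ <| by
          simp_rw [algebraMap_pairingIn, map_sum, ← root_coroot_eq_pairing]
          conv_lhs => rw [root_eq_sum b α]
          simp only [map_sum, LinearMap.sum_apply, map_zsmul, LinearMap.smul_apply, map_mul,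
            algebraMap_pairingIn, root_coroot_eq_pairing, zsmul_eq_mul]
          simp
      have : P.pairingIn ℤ α j ≤ 0 := by
        rw [e]
        refine Finset.sum_nonpos fun k _ => ?_
        by_cases hk : k ∈ J
        · refine mul_nonpos_of_nonneg_of_nonpos ((isPos_iff_coeff b).1 hpos k)
            (b.pairingIn_le_zero_of_ne ?_ k.2 j.2)
          intro h; exact hjJ (Subtype.ext h ▸ hk)
        · simp [h k hk]
      lia
    have hsj : weylGroup.ofIdx P (j : ι) ∈ parabolic b J := Subgroup.subset_closure ⟨j, hjJ, rfl⟩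
    by_cases hαj : α = j
    · rwa [hαj]
    · have hpos' := isPos_reflectionPerm b hpos j hαj
      have hcoeff : ∀ k, coeff b k (P.reflectionPerm j α) =
          coeff b k α - P.pairingIn ℤ α j * (if k = j then 1 else 0) :=
        fun k => coeff_reflectionPerm b j k α
      have hlt : b.height (P.reflectionPerm j α) < b.height α := by
        simp only [height_eq, hcoeff, Finset.sum_sub_distrib]
        simp [hj']
      have h0 := (b.isPos_iff).1 hpos'
      have hmem : weylGroup.ofIdx P (P.reflectionPerm j α) ∈ parabolic b J := by
        refine ih _ ?_ (fun k hk => ?_) hpos' rfl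
        · lia
        · rw [hcoeff, h k hk, if_neg fun h : k = j => hk (h ▸ hjJ)]; simp
      rw [← perm_ofIdx, ← ofIdx_conj] at hmem
      have := (parabolic b J).mul_mem
        ((parabolic b J).mul_mem ((parabolic b J).inv_mem hsj) hmem) hsj
      group at this
      exact this

end PartialFlag

end

/-! ### The moment graph under simple reflections. -/

noncomputable section

open RootPairing
open scoped Classical

namespace PartialFlag

variable {ι M N : Type*} [Finite ι] [AddCommGroup M] [Module ℂ M] [AddCommGroup N] [Module ℂ N]
  {P : RootPairing ι ℂ M N} [P.IsCrystallographic] (b : P.Base) (J : Set b.support)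

/-! ### Labels of the edges leaving a vertex -/

/-- The root `α` is the label of an edge directed out of `x`. -/
def IsLabel (x : Cosets b J) (α : ι) : Prop := ∃ y, Edge b J x α y

omit [Finite ι] in
lemma isNilMinus_congr {w w' : P.weylGroup} (h : (w : Cosets b J) = w') (α : ι) :
    IsNilMinus b J (P.weylGroupToPerm w⁻¹ α) ↔ IsNilMinus b J (P.weylGroupToPerm w'⁻¹ α) := by
  rw [QuotientGroup.eq] at h
  rw [← isNilMinus_perm b J h (α := P.weylGroupToPerm w'⁻¹ α), ← perm_mul]
  simp

omit [Finite ι] [P.IsCrystallographic] in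
lemma mk_ofIdx_mul_eq_iff (w : P.weylGroup) (α : ι) :
    ((weylGroup.ofIdx P α * w : P.weylGroup) : Cosets b J) = w ↔
      weylGroup.ofIdx P (P.weylGroupToPerm w⁻¹ α) ∈ parabolic b J := by
  rw [eq_comm, QuotientGroup.eq, ofIdx_mul_eq]
  simp

-- The condition x ≠ y in `Edge` is automatic: a reflection in a root with a nonzero coefficient
-- outside J does not lie in W_J.
omit [Finite ι] in
lemma edge_mk_iff {w : P.weylGroup} {α : ι} {y : Cosets b J} :
    Edge b J w α y ↔ b.IsPos α ∧ IsNilMinus b J (P.weylGroupToPerm w⁻¹ α) ∧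
      y = weylGroup.ofIdx P α • (w : Cosets b J) := by
  constructor
  · rintro ⟨h, -, w', hw', hy, h'⟩
    refine ⟨h, (isNilMinus_congr b J hw' α).1 h', ?_⟩
    rw [← hy, ← hw']; rfl
  · rintro ⟨h, h', rfl⟩
    refine ⟨h, fun he => ?_, w, rfl, rfl, h'⟩
    obtain ⟨k, hk, hlt⟩ := (isNilMinus_iff b J).1 h'
    exact ofIdx_notMem_parabolic b J hk hlt.ne ((mk_ofIdx_mul_eq_iff b J w α).1 he.symm)

omit [Finite ι] in
lemma isLabel_mk_iff {w : P.weylGroup} {α : ι} :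
    IsLabel b J w α ↔ b.IsPos α ∧ IsNilMinus b J (P.weylGroupToPerm w⁻¹ α) := by
  simp [IsLabel, edge_mk_iff]

omit [Finite ι] in
lemma edge_iff {x : Cosets b J} {α : ι} {y : Cosets b J} :
    Edge b J x α y ↔ IsLabel b J x α ∧ y = weylGroup.ofIdx P α • x := by
  induction x using QuotientGroup.induction_on with
  | H w => rw [edge_mk_iff, isLabel_mk_iff, and_assoc]

variable {b J}

omit [Finite ι] [P.IsCrystallographic] in
lemma IsLabel.isPos {x : Cosets b J} {α : ι} (h : IsLabel b J x α) : b.IsPos α := h.choose_spec.1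

omit [Finite ι] in
lemma IsLabel.edge {x : Cosets b J} {α : ι} (h : IsLabel b J x α) :
    Edge b J x α (weylGroup.ofIdx P α • x) := (edge_iff b J).2 ⟨h, rfl⟩

omit [Finite ι] in
lemma IsLabel.smul_ne {x : Cosets b J} {α : ι} (h : IsLabel b J x α) :
    weylGroup.ofIdx P α • x ≠ x := h.edge.2.1.symm

omit [Finite ι] [P.IsCrystallographic] in
lemma ofIdx_smul_smul (α : ι) (x : Cosets b J) :
    weylGroup.ofIdx P α • weylGroup.ofIdx P α • x = x := by
  rw [smul_smul, ofIdx_mul_self, one_smul]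

variable (b J)

omit [Finite ι] [P.IsCrystallographic] in
lemma isNilMinus_reflection_smul (i : b.support) (w : P.weylGroup) (α : ι) :
    P.weylGroupToPerm (weylGroup.ofIdx P (i : ι) * w)⁻¹ (P.reflectionPerm i α) =
      P.weylGroupToPerm w⁻¹ α := by
  rw [mul_inv_rev, perm_mul, ← perm_ofIdx, perm_inv_perm]

omit [Finite ι] in
lemma IsLabel.not_smul {i : b.support} {x : Cosets b J} (h : IsLabel b J x i) :
    ¬ IsLabel b J (weylGroup.ofIdx P (i : ι) • x) i := by
  induction x using QuotientGroup.induction_on with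
  | H w =>
    intro h'
    obtain ⟨-, h⟩ := (isLabel_mk_iff b J).1 h
    obtain ⟨-, h'⟩ := (isLabel_mk_iff (w := weylGroup.ofIdx P (i : ι) * w) b J).1 h'
    obtain ⟨k, hk, h⟩ := (isNilMinus_iff b J).1 h
    rw [mul_inv_rev, perm_mul, ofIdx_inv, perm_ofIdx] at h'
    have e : P.weylGroupToPerm w⁻¹ (P.reflectionPerm i i) =
        P.reflectionPerm (P.weylGroupToPerm w⁻¹ i) (P.weylGroupToPerm w⁻¹ i) := by
      rw [← perm_ofIdx, ← perm_ofIdx, ← ofIdx_conj, ← perm_mul, ← perm_mul]; simp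
    rw [e] at h'
    exact h'.1 ((isPos_reflectionPerm_self b).2 (not_isPos_of_coeff_neg b h))

variable [P.IsReduced]

variable {b J} in
lemma IsLabel.reflection {i : b.support} {x : Cosets b J} {α : ι} (h : IsLabel b J x α)
    (hα : α ≠ i) : IsLabel b J (weylGroup.ofIdx P (i : ι) • x) (P.reflectionPerm i α) := by
  induction x using QuotientGroup.induction_on with
  | H w =>
    rw [isLabel_mk_iff] at h
    refine (isLabel_mk_iff (w := weylGroup.ofIdx P (i : ι) * w) b J).2 ⟨?_, ?_⟩
    · exact isPos_reflectionPerm b h.1 i hα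
    · rw [isNilMinus_reflection_smul]; exact h.2

/-- The three cases are the sign of the coefficients of w⁻¹α_i outside J: some negative, some
positive, or all zero. -/
lemma isLabel_trichotomy (i : b.support) (x : Cosets b J) :
    IsLabel b J x i ∨ IsLabel b J (weylGroup.ofIdx P (i : ι) • x) i ∨
      weylGroup.ofIdx P (i : ι) • x = x := by
  induction x using QuotientGroup.induction_on with
  | H w =>
    by_cases h : ∀ k ∉ J, coeff b k (P.weylGroupToPerm w⁻¹ i) = 0
    · exact .inr (.inr ((mk_ofIdx_mul_eq_iff b J w i).2 (ofIdx_mem_parabolic b J h)))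
    · push Not at h
      obtain ⟨k, hk, h⟩ := h
      rcases h.lt_or_gt with h | h
      · exact .inl ((isLabel_mk_iff b J).2 ⟨isPos_simple b i, (isNilMinus_iff b J).2 ⟨k, hk, h⟩⟩)
      · refine .inr (.inl ((isLabel_mk_iff (w := weylGroup.ofIdx P (i : ι) * w) b J).2
          ⟨isPos_simple b i, (isNilMinus_iff b J).2 ⟨k, hk, ?_⟩⟩))
        have e := perm_ofIdx_mul_inv_self w (i : ι)
        rw [e, coeff_reflectionPerm_self]; lia

/-- The labels of the edges directed out of `x`. -/
def labels (x : Cosets b J) : Finset ι := (Set.toFinite {α | IsLabel b J x α}).toFinset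

variable {b J}

omit [P.IsCrystallographic] [P.IsReduced] in
@[simp] lemma mem_labels {x : Cosets b J} {α : ι} : α ∈ labels b J x ↔ IsLabel b J x α := by
  simp [labels]

variable (b J)

/-- The number of edges directed out of `x`. -/
def rk (x : Cosets b J) : ℕ := (labels b J x).card

lemma labels_smul {i : b.support} {x : Cosets b J} (h : IsLabel b J x i) :
    labels b J (weylGroup.ofIdx P (i : ι) • x) =
      ((labels b J x).erase i).map (P.reflectionPerm i).toEmbedding := by
  ext α
  simp only [mem_labels, Finset.mem_map, Finset.mem_erase, Equiv.toEmbedding_apply]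
  constructor
  · intro hα
    have hαi : α ≠ i := by rintro rfl; exact h.not_smul b J hα
    refine ⟨P.reflectionPerm i α, ⟨?_, ?_⟩, by simp⟩
    · intro he
      refine (isPos_reflectionPerm_self b (α := (i : ι))).1 ?_ (isPos_simple b i)
      -- If s_i α = α_i then α = -α_i, which is not positive.
      rw [← (P.reflectionPerm i).injective.eq_iff, P.reflectionPerm_self] at he
      rw [← he]; exact hα.isPos
    · simpa only [ofIdx_smul_smul] using hα.reflection hαi
  · rintro ⟨β, ⟨hβ, hβ'⟩, rfl⟩
    exact hβ'.reflection hβ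

lemma rk_eq {i : b.support} {x : Cosets b J} (h : IsLabel b J x i) :
    rk b J x = rk b J (weylGroup.ofIdx P (i : ι) • x) + 1 := by
  rw [rk, rk, labels_smul b J h, Finset.card_map, Finset.card_erase_add_one (mem_labels.2 h)]

lemma rk_le (i : b.support) (x : Cosets b J) :
    rk b J x ≤ rk b J (weylGroup.ofIdx P (i : ι) • x) + 1 := by
  rcases isLabel_trichotomy b J i x with h | h | h
  · exact (rk_eq b J h).le
  · have := rk_eq b J h
    rw [ofIdx_smul_smul] at this; lia
  · rw [h]; lia

lemma isLabel_of_rk_lt {i : b.support} {x : Cosets b J}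
    (h : rk b J (weylGroup.ofIdx P (i : ι) • x) < rk b J x) : IsLabel b J x i := by
  rcases isLabel_trichotomy b J i x with h' | h' | h'
  · exact h'
  · have := rk_eq b J h'
    rw [ofIdx_smul_smul] at this; lia
  · rw [h'] at h; lia

omit [P.IsCrystallographic] [P.IsReduced] in
lemma rk_le_card (x : Cosets b J) : rk b J x ≤ Nat.card ι := by
  have := Fintype.ofFinite ι
  rw [Nat.card_eq_fintype_card]
  exact Finset.card_le_univ _

omit [P.IsReduced] [Finite ι] in
/-- If no simple reflection moves `x` up, then no edge enters `x`. -/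
lemma not_isLabel_smul_of_forall {x : Cosets b J}
    (h : ∀ i : b.support, ¬ IsLabel b J (weylGroup.ofIdx P (i : ι) • x) i) (α : ι) :
    ¬ IsLabel b J (weylGroup.ofIdx P α • x) α := by
  induction x using QuotientGroup.induction_on with
  | H w =>
    have key (β : ι) : IsLabel b J (weylGroup.ofIdx P β • (w : Cosets b J)) β ↔
        b.IsPos β ∧ ∃ k ∉ J, 0 < coeff b k (P.weylGroupToPerm w⁻¹ β) := by
      refine (isLabel_mk_iff (w := weylGroup.ofIdx P β * w) b J).trans (and_congr_right fun _ => ?_)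
      have e := perm_ofIdx_mul_inv_self w β
      simp only [e, isNilMinus_iff, coeff_reflectionPerm_self, neg_lt_zero]
    simp only [key] at h ⊢
    rintro ⟨hα, k, hk, hpos⟩
    -- Expand w⁻¹α in the w⁻¹α_l: the weights are nonnegative, and the hypothesis makes each
    -- coefficient at k nonpositive.
    rw [coeff_perm] at hpos
    refine absurd (Finset.sum_nonpos fun l _ => ?_) (not_le.2 hpos)
    refine mul_nonpos_of_nonneg_of_nonpos ((isPos_iff_coeff b).1 hα l) ?_
    by_contra hc
    exact h l ⟨isPos_simple b l, k, hk, not_le.1 hc⟩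

/-! ### The order of the moment graph -/

variable {b J}

lemma edge_reflection {i : b.support} {x y : Cosets b J} {α : ι} (hα : α ≠ i)
    (h : Edge b J x α y) :
    Edge b J (weylGroup.ofIdx P (i : ι) • x) (P.reflectionPerm i α)
      (weylGroup.ofIdx P (i : ι) • y) := by
  obtain ⟨h', rfl⟩ := (edge_iff b J).1 h
  refine (edge_iff b J).2 ⟨h'.reflection hα, ?_⟩
  rw [← perm_ofIdx, ← ofIdx_conj, smul_smul, smul_smul]
  simp

omit [P.IsReduced] [Finite ι] [P.IsCrystallographic] in
lemma GraphLE.trans {x y z : Cosets b J} (h : GraphLE b J x y) (h' : GraphLE b J y z) :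
    GraphLE b J x z := Relation.ReflTransGen.trans h' h

omit [P.IsReduced] [Finite ι] [P.IsCrystallographic] in
lemma Edge.graphLE {x y : Cosets b J} {α : ι} (h : Edge b J x α y) : GraphLE b J y x :=
  Relation.ReflTransGen.single ⟨α, h⟩

omit [P.IsReduced] [Finite ι] in
lemma IsLabel.graphLE {x : Cosets b J} {α : ι} (h : IsLabel b J x α) :
    GraphLE b J (weylGroup.ofIdx P α • x) x := h.edge.graphLE

/-- The lifting property of the order of the moment graph. -/
lemma GraphLE.lifting {v u : Cosets b J} (h : GraphLE b J v u) {i : b.support}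
    (hi : IsLabel b J u i) :
    GraphLE b J v (weylGroup.ofIdx P (i : ι) • u) ∨
      IsLabel b J v i ∧
        GraphLE b J (weylGroup.ofIdx P (i : ι) • v) (weylGroup.ofIdx P (i : ι) • u) := by
  induction h using Relation.ReflTransGen.head_induction_on with
  | refl => exact .inr ⟨hi, .refl⟩
  | @head u u' hu h ih =>
    obtain ⟨α, hu⟩ := hu
    by_cases hα : α = i
    · subst hα
      obtain ⟨-, rfl⟩ := (edge_iff b J).1 hu
      exact .inl h
    · have hle := (edge_reflection hα hu).graphLE
      rcases isLabel_trichotomy b J i u' with h' | h' | h'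
      · rcases ih h' with h1 | ⟨h1, h2⟩
        · exact .inl (h1.trans hle)
        · exact .inr ⟨h1, h2.trans hle⟩
      · have := h'.graphLE
        rw [ofIdx_smul_smul] at this
        exact .inl ((GraphLE.trans h this).trans hle)
      · rw [h'] at hle
        exact .inl (GraphLE.trans h hle)

end PartialFlag

end

/-! ### Grading and divisibility in the symmetric algebra. -/

noncomputable section

open RootPairing
open scoped Classical

namespace PartialFlag

/-! ### The symmetric algebra of a vector space -/

section SymmetricAlgebra

variable {V : Type*} [AddCommGroup V] [Module ℂ V]

lemma mem_homogeneousS_iff {I : Type*} (B : Module.Basis I ℂ V) (d : ℕ)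
    (f : SymmetricAlgebra ℂ V) :
    f ∈ homogeneousS V d ↔ (SymmetricAlgebra.equivMvPolynomial B f).IsHomogeneous d := by
  set e := SymmetricAlgebra.equivMvPolynomial B
  have h1 : (LinearMap.range (SymmetricAlgebra.ι ℂ V)).map e.toAlgHom.toLinearMap =
      MvPolynomial.homogeneousSubmodule I ℂ 1 := by
    rw [MvPolynomial.homogeneousSubmodule_one_eq_span_X, ← LinearMap.range_comp,
      LinearMap.range_eq_map, ← B.span_eq, Submodule.map_span, ← Set.range_comp]
    congr 2
    ext i : 1
    exact SymmetricAlgebra.equivMvPolynomial_ι_apply B i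
  have h2 : (homogeneousS V d).map e.toAlgHom.toLinearMap =
      MvPolynomial.homogeneousSubmodule I ℂ d := by
    rw [homogeneousS, Submodule.map_pow, h1, MvPolynomial.homogeneousSubmodule_one_pow]
  rw [← MvPolynomial.mem_homogeneousSubmodule, ← h2, Submodule.mem_map]
  constructor
  · intro h; exact ⟨f, h, rfl⟩
  · rintro ⟨g, hg, h⟩
    rwa [← e.injective h]

/-- Used to turn given independent vectors into variables of a polynomial ring, where primality and
divisibility are evident. -/
lemma exists_basis_apply_eq {κ : Type*} {v : κ → V} (hv : LinearIndependent ℂ v) :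
    ∃ (I : Set V) (B : Module.Basis I ℂ V) (j : κ → I),
      Function.Injective j ∧ ∀ k, B (j k) = v k :=
  ⟨_, Module.Basis.extend hv.linearIndepOn_id,
    fun k => ⟨v k, Module.Basis.subset_extend _ (Set.mem_range_self k)⟩,
    fun _ _ h => hv.injective (congrArg Subtype.val h), fun _ => Module.Basis.extend_apply_self _ _⟩

lemma exists_basis_of_ne_zero {x : V} (hx : x ≠ 0) :
    ∃ (I : Set V) (B : Module.Basis I ℂ V) (j : I), B j = x := by
  obtain ⟨I, B, j, -, h⟩ :=
    exists_basis_apply_eq (LinearIndependent.of_subsingleton (v := fun _ : Unit => x) () hx)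
  exact ⟨I, B, j (), h ()⟩

lemma prime_ι {x : V} (hx : x ≠ 0) : Prime (SymmetricAlgebra.ι ℂ V x) := by
  obtain ⟨I, B, j, rfl⟩ := exists_basis_of_ne_zero hx
  rw [← MulEquiv.prime_iff (SymmetricAlgebra.equivMvPolynomial B),
    SymmetricAlgebra.equivMvPolynomial_ι_apply]
  exact MvPolynomial.X_prime

lemma not_ι_dvd_ι {x y : V} (h : LinearIndependent ℂ ![x, y]) :
    ¬ SymmetricAlgebra.ι ℂ V x ∣ SymmetricAlgebra.ι ℂ V y := by
  obtain ⟨I, B, j, hj, h⟩ := exists_basis_apply_eq h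
  intro hd
  have := map_dvd (SymmetricAlgebra.equivMvPolynomial B) hd
  have h0 : B (j 0) = x := h 0
  have h1 : B (j 1) = y := h 1
  rw [← h0, ← h1, SymmetricAlgebra.equivMvPolynomial_ι_apply,
    SymmetricAlgebra.equivMvPolynomial_ι_apply, MvPolynomial.X_dvd_X] at this
  exact absurd (hj this) (by decide)

lemma ι_mem_homogeneousS (x : V) : SymmetricAlgebra.ι ℂ V x ∈ homogeneousS V 1 := by
  rw [homogeneousS, pow_one]; exact ⟨x, rfl⟩

lemma mul_mem_homogeneousS {d e : ℕ} {f g : SymmetricAlgebra ℂ V} (hf : f ∈ homogeneousS V d)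
    (hg : g ∈ homogeneousS V e) : f * g ∈ homogeneousS V (d + e) := by
  rw [homogeneousS, pow_add]; exact Submodule.mul_mem_mul hf hg

lemma prod_ι_mem_homogeneousS {κ : Type*} (s : Finset κ) (v : κ → V) :
    ∏ k ∈ s, SymmetricAlgebra.ι ℂ V (v k) ∈ homogeneousS V s.card := by
  induction s using Finset.induction_on with
  | empty => simp [homogeneousS]
  | insert a s ha ih =>
    rw [Finset.prod_insert ha, Finset.card_insert_of_notMem ha, add_comm]
    exact mul_mem_homogeneousS (ι_mem_homogeneousS _) ih

lemma eq_of_mem_homogeneousS {d e : ℕ} {f : SymmetricAlgebra ℂ V} (hd : f ∈ homogeneousS V d)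
    (he : f ∈ homogeneousS V e) (hf : f ≠ 0) : d = e := by
  have B := Module.Basis.ofVectorSpace ℂ V
  rw [mem_homogeneousS_iff B] at hd he
  exact hd.inj_right he ((map_ne_zero_iff _ (AlgEquiv.injective _)).2 hf)

/-- With x as a variable, multiplication raises the degree of each monomial by one; a monomial of f
shows that d is positive. -/
lemma of_ι_mul_mem_homogeneousS {x : V} (hx : x ≠ 0) {d : ℕ} {f : SymmetricAlgebra ℂ V}
    (h : SymmetricAlgebra.ι ℂ V x * f ∈ homogeneousS V d) (hf : f ≠ 0) :
    ∃ e, d = e + 1 ∧ f ∈ homogeneousS V e := by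
  obtain ⟨I, B, j, rfl⟩ := exists_basis_of_ne_zero hx
  rw [mem_homogeneousS_iff B, map_mul, SymmetricAlgebra.equivMvPolynomial_ι_apply] at h
  simp_rw [mem_homogeneousS_iff B]
  have hf' : SymmetricAlgebra.equivMvPolynomial B f ≠ 0 :=
    (map_ne_zero_iff _ (AlgEquiv.injective _)).2 hf
  set g := SymmetricAlgebra.equivMvPolynomial B f
  have key : ∀ m, g.coeff m ≠ 0 → d = m.degree + 1 := by
    intro m hm
    rw [← MvPolynomial.coeff_X_mul m j] at hm
    by_contra hne
    refine hm (h.coeff_eq_zero ?_)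
    rw [map_add, Finsupp.degree_single]; lia
  obtain ⟨m, hm⟩ := MvPolynomial.ne_zero_iff.1 hf'
  refine ⟨m.degree, key m hm, fun m' hm' => ?_⟩
  have := key m' hm'
  rw [key m hm] at this
  rw [Pi.one_def, ← Finsupp.degree_eq_weight_one]
  lia

lemma card_le_of_prod_ι_dvd {κ : Type*} (s : Finset κ) (v : κ → V) (hv : ∀ k ∈ s, v k ≠ 0)
    {d : ℕ} {f : SymmetricAlgebra ℂ V} (hd : f ∈ homogeneousS V d) (hf : f ≠ 0)
    (h : ∏ k ∈ s, SymmetricAlgebra.ι ℂ V (v k) ∣ f) : s.card ≤ d := by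
  induction s using Finset.induction_on generalizing d f with
  | empty => simp
  | insert a s ha ih =>
    obtain ⟨g, rfl⟩ := h
    rw [Finset.prod_insert ha, mul_assoc] at hd hf
    obtain ⟨e, rfl, he⟩ := of_ι_mul_mem_homogeneousS (hv a (by simp)) hd (right_ne_zero_of_mul hf)
    rw [Finset.card_insert_of_notMem ha]
    exact Nat.succ_le_succ (ih (fun k hk => hv k (by simp [hk])) he (right_ne_zero_of_mul hf)
      (Dvd.intro _ rfl))

lemma prod_dvd_of_pairwise {R κ : Type*} [CommRing R] [IsDomain R] (s : Finset κ) (a : κ → R)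
    (ha : ∀ k ∈ s, Prime (a k)) (hne : ∀ k ∈ s, ∀ l ∈ s, k ≠ l → ¬ a k ∣ a l) {f : R}
    (h : ∀ k ∈ s, a k ∣ f) : ∏ k ∈ s, a k ∣ f := by
  induction s using Finset.induction_on generalizing f with
  | empty => simp
  | insert k s hk ih =>
    obtain ⟨g, rfl⟩ := h k (by simp)
    rw [Finset.prod_insert hk]
    refine mul_dvd_mul_left _ (ih (fun l hl => ha l (by simp [hl]))
      (fun l hl m hm => hne l (by simp [hl]) m (by simp [hm])) fun l hl => ?_)
    refine ((ha l (by simp [hl])).dvd_or_dvd (h l (by simp [hl]))).resolve_left ?_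
    exact hne l (by simp [hl]) k (by simp) (by rintro rfl; exact hk hl)

end SymmetricAlgebra

/-! ### Roots and the Weyl group in the symmetric algebra -/

variable {ι M N : Type*} [AddCommGroup M] [Module ℂ M] [AddCommGroup N] [Module ℂ N]
  {P : RootPairing ι ℂ M N}

lemma prime_rootS (α : ι) : Prime (rootS P α) := prime_ι (P.ne_zero α)

lemma rootS_ne_zero (α : ι) : rootS P α ≠ 0 := (prime_rootS α).ne_zero

@[simp] lemma actS_ι (w : P.weylGroup) (m : M) :
    actS w (SymmetricAlgebra.ι ℂ M m) = SymmetricAlgebra.ι ℂ M (w • m) := by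
  rw [actS, SymmetricAlgebra.lift_ι_apply]; rfl

lemma actS_rootS (w : P.weylGroup) (α : ι) :
    actS w (rootS P α) = rootS P (P.weylGroupToPerm w α) := by
  rw [rootS, actS_ι, rootS, root_perm]

lemma actS_one (f : SymmetricAlgebra ℂ M) : actS (1 : P.weylGroup) f = f := by
  have : actS (1 : P.weylGroup) = AlgHom.id ℂ (SymmetricAlgebra ℂ M) :=
    SymmetricAlgebra.algHom_ext (by ext; simp)
  rw [this]; rfl

lemma actS_mul (w w' : P.weylGroup) (f : SymmetricAlgebra ℂ M) :
    actS (w * w') f = actS w (actS w' f) := by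
  have : actS (w * w') = (actS w).comp (actS w') :=
    SymmetricAlgebra.algHom_ext (by ext; simp [mul_smul])
  rw [this]; rfl

lemma actS_ofIdx_ofIdx (α : ι) (f : SymmetricAlgebra ℂ M) :
    actS (weylGroup.ofIdx P α) (actS (weylGroup.ofIdx P α) f) = f := by
  rw [← actS_mul, ofIdx_mul_self, actS_one]

lemma rootS_reflectionPerm_self (α : ι) : rootS P (P.reflectionPerm α α) = -rootS P α := by
  simp [rootS]

lemma actS_ofIdx_rootS_self (α : ι) : actS (weylGroup.ofIdx P α) (rootS P α) = -rootS P α := by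
  rw [actS_rootS, perm_ofIdx, rootS_reflectionPerm_self]

lemma actS_mem_homogeneousS (w : P.weylGroup) {d : ℕ} {f : SymmetricAlgebra ℂ M}
    (hf : f ∈ homogeneousS M d) : actS w f ∈ homogeneousS M d := by
  have h : (homogeneousS M d).map (actS w).toLinearMap ≤ homogeneousS M d := by
    rw [homogeneousS, Submodule.map_pow]
    refine pow_le_pow_left' ?_ d
    rw [← LinearMap.range_comp]
    rintro _ ⟨m, rfl⟩
    exact ⟨w • m, (actS_ι w m).symm⟩
  exact h ⟨f, hf, rfl⟩

/-- Modulo α, the reflection s_α is the identity on linear forms, hence on the algebra they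
generate. -/
lemma rootS_dvd_sub_actS (α : ι) (f : SymmetricAlgebra ℂ M) :
    rootS P α ∣ f - actS (weylGroup.ofIdx P α) f := by
  have : (Ideal.Quotient.mkₐ ℂ (Ideal.span {rootS P α})).comp (actS (weylGroup.ofIdx P α)) =
      Ideal.Quotient.mkₐ ℂ (Ideal.span {rootS P α}) := by
    refine SymmetricAlgebra.algHom_ext (LinearMap.ext fun m => ?_)
    refine (Ideal.Quotient.mk_eq_mk_iff_sub_mem _ _).2 ?_
    change actS _ (SymmetricAlgebra.ι ℂ M m) - SymmetricAlgebra.ι ℂ M m ∈ _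
    rw [actS_ι, ← map_sub, ofIdx_smul_eq, reflection_apply, sub_sub_cancel_left, map_neg, map_smul]
    exact neg_mem (Submodule.smul_of_tower_mem _ _ (Ideal.mem_span_singleton_self _))
  rw [← Ideal.mem_span_singleton, ← Ideal.Quotient.mk_eq_mk_iff_sub_mem]
  exact (AlgHom.congr_fun this f).symm

lemma not_rootS_dvd_rootS [P.IsReduced] (b : P.Base) {α β : ι} (hα : b.IsPos α) (hβ : b.IsPos β)
    (h : α ≠ β) : ¬ rootS P α ∣ rootS P β := by
  refine not_ι_dvd_ι (IsReduced.linearIndependent P h fun h' => ?_)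
  have : α = P.reflectionPerm β β := P.root.injective (by simpa using h')
  exact (isPos_reflectionPerm_self b).1 (this ▸ hα) hβ

/-- A functional taking the value `1` on the simple roots. -/
lemma exists_dual_simple_eq_one (b : P.Base) :
    ∃ φ : M →ₗ[ℂ] ℂ, ∀ i : b.support, φ (P.root i) = 1 := by
  obtain ⟨I, B, j, -, h⟩ := exists_basis_apply_eq b.linearIndepOn_root
  exact ⟨B.constr ℂ fun _ => 1, fun i => by
    have : P.root i = B (j i) := (h i).symm
    rw [this, B.constr_basis]⟩

/-- Evaluation of polynomials at a point where every simple root takes the value `1`. -/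
def evalHeight (b : P.Base) : SymmetricAlgebra ℂ M →ₐ[ℂ] ℂ :=
  SymmetricAlgebra.lift (exists_dual_simple_eq_one b).choose

lemma evalHeight_rootS (b : P.Base) (α : ι) : evalHeight b (rootS P α) = b.height α := by
  rw [evalHeight, rootS, SymmetricAlgebra.lift_ι_apply, root_eq_sum b, map_sum, height_eq]
  push_cast
  refine Finset.sum_congr rfl fun k _ => ?_
  rw [map_zsmul, (exists_dual_simple_eq_one b).choose_spec k]
  simp

end PartialFlag

end

noncomputable section

open RootPairing
open scoped Classical

namespace PartialFlag

variable {ι M N : Type*} [Finite ι] [AddCommGroup M] [Module ℂ M] [AddCommGroup N] [Module ℂ N]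
  {P : RootPairing ι ℂ M N} (b : P.Base) (J : Set b.support)

/-! ### Divided differences -/

omit [Finite ι] in
lemma rootS_mul_cancel {α : ι} {f g : SymmetricAlgebra ℂ M}
    (h : rootS P α * f = rootS P α * g) : f = g :=
  mul_left_cancel₀ (rootS_ne_zero α) h

/-- The divided difference `(f - s_α f) / α`. -/
def divDiffFun (P : RootPairing ι ℂ M N) (α : ι) (f : SymmetricAlgebra ℂ M) :
    SymmetricAlgebra ℂ M :=
  (rootS_dvd_sub_actS (P := P) α f).choose

omit [Finite ι] in
lemma rootS_mul_divDiffFun (α : ι) (f : SymmetricAlgebra ℂ M) :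
    rootS P α * divDiffFun P α f = f - actS (weylGroup.ofIdx P α) f :=
  (rootS_dvd_sub_actS (P := P) α f).choose_spec.symm

/-- The divided difference operator `f ↦ (f - s_α f) / α`. -/
def divDiff (P : RootPairing ι ℂ M N) (α : ι) :
    SymmetricAlgebra ℂ M →ₗ[ℂ] SymmetricAlgebra ℂ M where
  toFun := divDiffFun P α
  map_add' f g := rootS_mul_cancel (P := P) (α := α) <| by
    rw [mul_add, rootS_mul_divDiffFun, rootS_mul_divDiffFun, rootS_mul_divDiffFun, map_add]; ring
  map_smul' c f := rootS_mul_cancel (P := P) (α := α) <| by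
    rw [RingHom.id_apply, mul_smul_comm, rootS_mul_divDiffFun, rootS_mul_divDiffFun, map_smul,
      smul_sub]

omit [Finite ι] in
lemma rootS_mul_divDiff (α : ι) (f : SymmetricAlgebra ℂ M) :
    rootS P α * divDiff P α f = f - actS (weylGroup.ofIdx P α) f :=
  rootS_mul_divDiffFun α f

omit [Finite ι] in
lemma actFun_ofIdx {α : ι} (p : Cosets b J → SymmetricAlgebra ℂ M) (x : Cosets b J) :
    actFun (weylGroup.ofIdx P α) p x =
      actS (weylGroup.ofIdx P α) (p (weylGroup.ofIdx P α • x)) := by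
  rw [actFun, ofIdx_inv]

variable [P.IsCrystallographic] [P.IsReduced]

lemma rootS_dvd_sub (q : GKM b J) (i : b.support) (x : Cosets b J) :
    rootS P i ∣ q.1 x - q.1 (weylGroup.ofIdx P (i : ι) • x) := by
  rcases isLabel_trichotomy b J i x with h | h | h
  · exact Ideal.mem_span_singleton.1 (q.2 _ _ _ h.edge)
  · have := Ideal.mem_span_singleton.1 (q.2 _ _ _ h.edge)
    rw [ofIdx_smul_smul] at this
    rwa [dvd_sub_comm]
  · rw [h, sub_self]; exact dvd_zero _

lemma rootS_dvd_sub_actFun (q : GKM b J) (i : b.support) (x : Cosets b J) :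
    rootS P i ∣ q.1 x - actFun (weylGroup.ofIdx P (i : ι)) q.1 x := by
  rw [actFun_ofIdx, ← sub_add_sub_cancel _ (q.1 (weylGroup.ofIdx P (i : ι) • x))]
  exact dvd_add (rootS_dvd_sub b J q i x) (rootS_dvd_sub_actS _ _)

/-- The values of the left divided difference `(q - s_i · q) / α_i`. -/
def leftDivFun (i : b.support) (q : GKM b J) (x : Cosets b J) : SymmetricAlgebra ℂ M :=
  (rootS_dvd_sub_actFun b J q i x).choose

lemma rootS_mul_leftDivFun (i : b.support) (q : GKM b J) (x : Cosets b J) :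
    rootS P i * leftDivFun b J i q x =
      q.1 x - actS (weylGroup.ofIdx P (i : ι)) (q.1 (weylGroup.ofIdx P (i : ι) • x)) := by
  rw [← actFun_ofIdx]
  exact (rootS_dvd_sub_actFun b J q i x).choose_spec.symm

/-- Both q - s_i · q and α_i change sign under s_i, so the quotient is s_i-invariant; hence δ_i² =
0. -/
lemma leftDivFun_smul (i : b.support) (q : GKM b J) (x : Cosets b J) :
    leftDivFun b J i q (weylGroup.ofIdx P (i : ι) • x) =
      actS (weylGroup.ofIdx P (i : ι)) (leftDivFun b J i q x) := by
  have h := congrArg (actS (weylGroup.ofIdx P (i : ι))) (rootS_mul_leftDivFun b J i q x)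
  rw [map_mul, map_sub, actS_ofIdx_ofIdx, actS_ofIdx_rootS_self] at h
  refine rootS_mul_cancel (P := P) (α := (i : ι)) ?_
  rw [rootS_mul_leftDivFun, ofIdx_smul_smul]
  linear_combination h

lemma leftDivFun_mem (i : b.support) (q : GKM b J) : leftDivFun b J i q ∈ GKM b J := by
  intro x α y hxy
  rw [Ideal.mem_span_singleton]
  by_cases hα : α = i
  · subst hα
    obtain ⟨-, rfl⟩ := (edge_iff b J).1 hxy
    rw [leftDivFun_smul]
    exact rootS_dvd_sub_actS _ _
  · have h1 := Ideal.mem_span_singleton.1 (q.2 _ _ _ hxy)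
    have h2 := map_dvd (actS (weylGroup.ofIdx P (i : ι)))
      (Ideal.mem_span_singleton.1 (q.2 _ _ _ (edge_reflection hα hxy)))
    rw [actS_rootS, perm_ofIdx, P.reflectionPerm_self, map_sub] at h2
    -- The prime α divides α_i times the difference: apply the GKM condition to the edge itself and,
    -- transported by s_i, to its reflected edge.
    refine ((prime_rootS α).dvd_or_dvd (a := rootS P i) ?_).resolve_left
      (not_rootS_dvd_rootS b hxy.1 (isPos_simple b i) hα)
    rw [mul_sub, rootS_mul_leftDivFun, rootS_mul_leftDivFun, sub_sub_sub_comm]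
    exact dvd_sub h1 h2

/-- The left divided difference operator `q ↦ (q - s_i · q) / α_i`. -/
def leftDiv (i : b.support) : GKM b J →ₗ[ℂ] GKM b J where
  toFun q := ⟨leftDivFun b J i q, leftDivFun_mem b J i q⟩
  map_add' p q := Subtype.ext <| funext fun x => rootS_mul_cancel (P := P) (α := (i : ι)) <| by
    change _ = _ * (leftDivFun b J i p x + leftDivFun b J i q x)
    rw [mul_add, rootS_mul_leftDivFun, rootS_mul_leftDivFun, rootS_mul_leftDivFun]
    simp only [Subalgebra.coe_add, Pi.add_apply, map_add]
    ring
  map_smul' c q := Subtype.ext <| funext fun x => rootS_mul_cancel (P := P) (α := (i : ι)) <| by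
    change _ = _ * (c • leftDivFun b J i q x)
    rw [mul_smul_comm, rootS_mul_leftDivFun, rootS_mul_leftDivFun]
    simp only [Subalgebra.coe_smul, Pi.smul_apply, map_smul, smul_sub]

variable {b J}

lemma rootS_mul_leftDiv (i : b.support) (q : GKM b J) (x : Cosets b J) :
    rootS P i * (leftDiv b J i q).1 x =
      q.1 x - actS (weylGroup.ofIdx P (i : ι)) (q.1 (weylGroup.ofIdx P (i : ι) • x)) :=
  rootS_mul_leftDivFun b J i q x

lemma leftDiv_smul_apply (i : b.support) (q : GKM b J) (x : Cosets b J) :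
    (leftDiv b J i q).1 (weylGroup.ofIdx P (i : ι) • x) =
      actS (weylGroup.ofIdx P (i : ι)) ((leftDiv b J i q).1 x) :=
  leftDivFun_smul b J i q x

lemma leftDiv_leftDiv (i : b.support) (q : GKM b J) : leftDiv b J i (leftDiv b J i q) = 0 :=
  Subtype.ext <| funext fun x => rootS_mul_cancel (P := P) (α := (i : ι)) <| by
    rw [rootS_mul_leftDiv, leftDiv_smul_apply, actS_ofIdx_ofIdx, sub_self]
    simp

lemma leftDiv_smul (i : b.support) (c : SymmetricAlgebra ℂ M) (q : GKM b J) :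
    leftDiv b J i (c • q) =
      divDiff P i c • q + actS (weylGroup.ofIdx P (i : ι)) c • leftDiv b J i q :=
  Subtype.ext <| funext fun x => rootS_mul_cancel (P := P) (α := (i : ι)) <| by
    have h1 := rootS_mul_divDiff (P := P) i c
    have h2 := rootS_mul_leftDiv i q x
    rw [rootS_mul_leftDiv]
    simp only [Subalgebra.coe_add, Subalgebra.coe_smul, Pi.add_apply, Pi.smul_apply, smul_eq_mul,
      map_mul]
    linear_combination -(q.1 x) * h1 - actS (weylGroup.ofIdx P (i : ι)) c * h2

lemma leftDiv_apply_ne_zero {i : b.support} {q : GKM b J} {x : Cosets b J}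
    (h : (leftDiv b J i q).1 x ≠ 0) :
    q.1 x ≠ 0 ∨ q.1 (weylGroup.ofIdx P (i : ι) • x) ≠ 0 := by
  by_contra! h'
  refine h (rootS_mul_cancel (P := P) (α := (i : ι)) ?_)
  rw [rootS_mul_leftDiv, h'.1, h'.2]; simp

lemma leftDiv_mem_homogeneousS {i : b.support} {q : GKM b J} {d : ℕ}
    (hq : ∀ x, q.1 x ∈ homogeneousS M d) {x : Cosets b J} (h : (leftDiv b J i q).1 x ≠ 0) :
    ∃ e, d = e + 1 ∧ (leftDiv b J i q).1 x ∈ homogeneousS M e := by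
  refine of_ι_mul_mem_homogeneousS (x := P.root i) (P.ne_zero i) ?_ h
  change rootS P i * _ ∈ _
  rw [rootS_mul_leftDiv]
  exact sub_mem (hq x) (actS_mem_homogeneousS _ (hq _))

end PartialFlag

end

/-! ### Comparison of labels with length and Bruhat order. -/

noncomputable section

open RootPairing
open scoped Classical

namespace PartialFlag

variable {ι M N : Type*} [Finite ι] [AddCommGroup M] [Module ℂ M] [AddCommGroup N] [Module ℂ N]
  {P : RootPairing ι ℂ M N} (b : P.Base)

/-! ### Words and lengths -/

omit [Finite ι] in
@[simp] lemma wordProd_nil : wordProd b [] = 1 := rfl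

omit [Finite ι] in
@[simp] lemma wordProd_cons (i : b.support) (l : List b.support) :
    wordProd b (i :: l) = weylGroup.ofIdx P (i : ι) * wordProd b l := by
  simp [wordProd]

omit [Finite ι] in
lemma wordProd_append (l l' : List b.support) :
    wordProd b (l ++ l') = wordProd b l * wordProd b l' := by
  simp [wordProd]

omit [Finite ι] in
lemma length_wordProd_le (l : List b.support) : length b (wordProd b l) ≤ l.length :=
  Nat.sInf_le ⟨l, rfl, rfl⟩

variable [P.IsCrystallographic] [P.IsReduced]

lemma exists_wordProd_eq (w : P.weylGroup) : ∃ l, wordProd b l = w := by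
  have mul {w w' : P.weylGroup} (h : ∃ l, wordProd b l = w) (h' : ∃ l, wordProd b l = w') :
      ∃ l, wordProd b l = w * w' := by
    obtain ⟨l, rfl⟩ := h
    obtain ⟨l', rfl⟩ := h'
    exact ⟨l ++ l', wordProd_append b l l'⟩
  have refl (α : ι) : ∃ l, wordProd b l = weylGroup.ofIdx P α := by
    refine Base.induction_reflect (b := b) α (p := fun α => ∃ l, wordProd b l = weylGroup.ofIdx P α)
      (fun α h => ?_) (fun i hi => ⟨[⟨i, hi⟩], by simp⟩) fun α i h hi => ?_
    · rwa [ofIdx_reflectionPerm_self]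
    · have hi' : ∃ l, wordProd b l = weylGroup.ofIdx P i := ⟨[⟨i, hi⟩], by simp⟩
      rw [← perm_ofIdx, ← ofIdx_conj, ofIdx_inv]
      exact mul (mul hi' h) hi'
  obtain ⟨g, hg⟩ := w
  induction hg using weylGroup.induction with
  | mem α => exact refl α
  | one => exact ⟨[], rfl⟩
  | mul x y hx hy ihx ihy => exact mul ihx ihy

lemma exists_isReducedWord (w : P.weylGroup) : ∃ l, IsReducedWord b l w := by
  obtain ⟨l, hl⟩ := exists_wordProd_eq b w
  exact Nat.sInf_mem (s := {k | ∃ l : List b.support, wordProd b l = w ∧ l.length = k})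
    ⟨_, l, hl, rfl⟩

/-- The strong exchange property. -/
lemma exists_wordProd_eq_ofIdx_mul (l : List b.support) {α : ι} (hα : b.IsPos α)
    (h : ¬ b.IsPos (P.weylGroupToPerm (wordProd b l)⁻¹ α)) :
    ∃ l' : List b.support, l'.length < l.length ∧
      wordProd b l' = weylGroup.ofIdx P α * wordProd b l := by
  induction l generalizing α with
  | nil => simp [hα] at h
  | cons i t ih =>
    by_cases hαi : α = i
    · exact ⟨t, by simp, by rw [hαi, wordProd_cons, ← mul_assoc, ofIdx_mul_self, one_mul]⟩
    · rw [wordProd_cons, mul_inv_rev, perm_mul, ofIdx_inv, perm_ofIdx] at h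
      obtain ⟨t', ht', h'⟩ := ih (isPos_reflectionPerm b hα i hαi) h
      refine ⟨i :: t', by simpa using ht', ?_⟩
      rw [wordProd_cons, h', wordProd_cons, ← perm_ofIdx, ← ofIdx_conj, ofIdx_inv]
      simp only [← mul_assoc, ofIdx_mul_self, one_mul]

lemma length_ofIdx_mul_lt {w : P.weylGroup} {α : ι} (hα : b.IsPos α)
    (h : ¬ b.IsPos (P.weylGroupToPerm w⁻¹ α)) :
    length b (weylGroup.ofIdx P α * w) < length b w := by
  obtain ⟨l, rfl, hl⟩ := exists_isReducedWord b w
  obtain ⟨l', hl', h'⟩ := exists_wordProd_eq_ofIdx_mul b l hα h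
  rw [← h', ← hl]
  exact (length_wordProd_le b l').trans_lt hl'

lemma length_ofIdx_mul_le (i : b.support) (w : P.weylGroup) :
    length b (weylGroup.ofIdx P (i : ι) * w) ≤ length b w + 1 := by
  obtain ⟨l, rfl, hl⟩ := exists_isReducedWord b w
  rw [← wordProd_cons, ← hl]
  exact length_wordProd_le b _

/-- If a reduced word of w began with i, its tail t would have t⁻¹α_i negative, making w = s_i t
shorter than t. -/
lemma eq_one_of_forall_isPos {w : P.weylGroup}
    (h : ∀ i : b.support, b.IsPos (P.weylGroupToPerm w⁻¹ i)) : w = 1 := by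
  obtain ⟨l, rfl, hl⟩ := exists_isReducedWord b w
  cases l with
  | nil => rfl
  | cons i t =>
    exfalso
    have h1 : P.weylGroupToPerm (wordProd b t)⁻¹ i =
        P.reflectionPerm (P.weylGroupToPerm (wordProd b (i :: t))⁻¹ i)
          (P.weylGroupToPerm (wordProd b (i :: t))⁻¹ i) := by
      rw [← perm_ofIdx, ← ofIdx_conj, ← perm_mul]; simp
    have h2 := length_ofIdx_mul_lt b (w := wordProd b t) (isPos_simple b i)
      (by rw [h1, isPos_reflectionPerm_self, not_not]; exact h i)
    rw [← wordProd_cons, ← hl] at h2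
    have := length_wordProd_le b t
    simp only [List.length_cons] at h2
    lia

include b in
lemma weylGroupToPerm_injective : Function.Injective P.weylGroupToPerm := by
  refine (injective_iff_map_eq_one _).2 fun w hw => eq_one_of_forall_isPos b fun i => ?_
  rw [map_inv, hw]
  exact isPos_simple b i

include b in
lemma finite_weylGroup : Finite P.weylGroup := Finite.of_injective _ (weylGroupToPerm_injective b)

/-! ### The Bruhat order on cosets and simple reflections -/

variable (J : Set b.support)

omit [Finite ι] [P.IsCrystallographic] [P.IsReduced] in
lemma exists_isMinRep (x : Cosets b J) : ∃ w, IsMinRep b J w x := by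
  obtain ⟨w₀, h₀⟩ := QuotientGroup.mk_surjective x
  have hne : {k | ∃ w : P.weylGroup, (w : Cosets b J) = x ∧ length b w = k}.Nonempty :=
    ⟨_, w₀, h₀, rfl⟩
  obtain ⟨w, hw, h⟩ := Nat.sInf_mem hne
  exact ⟨w, hw, fun u hu => h.trans_le (Nat.sInf_le ⟨u, hu, rfl⟩)⟩

omit [Finite ι] [P.IsCrystallographic] [P.IsReduced] in
lemma mk_ofIdx_mul {w : P.weylGroup} {x : Cosets b J} (h : (w : Cosets b J) = x) (α : ι) :
    ((weylGroup.ofIdx P α * w : P.weylGroup) : Cosets b J) = weylGroup.ofIdx P α • x := by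
  rw [← h]; rfl

lemma length_ofIdx_mul_lt_of_isLabel {w : P.weylGroup} {x : Cosets b J} {α : ι}
    (hw : (w : Cosets b J) = x) (h : IsLabel b J x α) :
    length b (weylGroup.ofIdx P α * w) < length b w := by
  rw [← hw] at h
  obtain ⟨hα, h⟩ := (isLabel_mk_iff b J).1 h
  exact length_ofIdx_mul_lt b hα h.1

lemma cosetLT_smul_iff (i : b.support) (v : Cosets b J) :
    CosetLT b J (weylGroup.ofIdx P (i : ι) • v) v ↔ IsLabel b J v i := by
  constructor
  · rintro ⟨⟨v', w, hv', hw, l, ⟨rfl, hl⟩, l', hsub, rfl⟩, hne⟩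
    rcases isLabel_trichotomy b J i v with h | h | h
    · exact h
    · exfalso
      have h1 := length_ofIdx_mul_lt_of_isLabel b J hv'.1 h
      have h2 := hw.2 (weylGroup.ofIdx P (i : ι) * wordProd b l')
        (by rw [mk_ofIdx_mul b J hv'.1, ofIdx_smul_smul])
      have h3 := length_wordProd_le b l'
      have h4 := hsub.length_le
      lia
    · exact absurd h hne
  · intro h
    refine ⟨?_, h.smul_ne⟩
    obtain ⟨w, hw, hmin⟩ := exists_isMinRep b J v
    have hlt := length_ofIdx_mul_lt_of_isLabel b J hw h
    obtain ⟨l, hl, hl'⟩ := exists_isReducedWord b (weylGroup.ofIdx P (i : ι) * w)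
    have hcons : wordProd b (i :: l) = w := by
      rw [wordProd_cons, hl, ← mul_assoc, ofIdx_mul_self, one_mul]
    -- For minimal w the product s_i w is again minimal, and prefixing i to its reduced word gives a
    -- reduced word of w.
    refine ⟨weylGroup.ofIdx P (i : ι) * w, w, ⟨mk_ofIdx_mul b J hw i, fun u hu => ?_⟩, ⟨hw, hmin⟩,
      i :: l, ⟨hcons, ?_⟩, l, by simp, hl⟩
    · have h1 := hmin (weylGroup.ofIdx P (i : ι) * u) (by rw [mk_ofIdx_mul b J hu, ofIdx_smul_smul])
      have h2 := length_ofIdx_mul_le b i u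
      lia
    · have h1 := length_wordProd_le b (i :: l)
      rw [hcons] at h1
      simp only [List.length_cons] at h1 ⊢
      lia

/-- The least length of a representative of a coset. -/
def minLength (x : Cosets b J) : ℕ := length b (exists_isMinRep b J x).choose

/-- Supplies well-foundedness of the graph; that rk also drops along every edge is known only after
the supports are computed (`Edge.rk_lt`). -/
lemma Edge.minLength_lt {x y : Cosets b J} {α : ι} (h : Edge b J x α y) :
    minLength b J y < minLength b J x := by
  obtain ⟨h', rfl⟩ := (edge_iff b J).1 h
  have hx := (exists_isMinRep b J x).choose_spec.1
  exact ((exists_isMinRep b J _).choose_spec.2 _ (mk_ofIdx_mul b J hx α)).trans_lt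
    (length_ofIdx_mul_lt_of_isLabel b J hx h')

end PartialFlag

end

/-! ### Schubert classes: construction, support and basis. -/

noncomputable section

open RootPairing
open scoped Classical

namespace PartialFlag

variable {ι M N : Type*} [Finite ι] [AddCommGroup M] [Module ℂ M] [AddCommGroup N] [Module ℂ N]
  {P : RootPairing ι ℂ M N} (b : P.Base) (J : Set b.support)

/-! ### Products of labels -/

/-- The product of the labels of the edges directed out of `x`. -/
def labelProd (x : Cosets b J) : SymmetricAlgebra ℂ M := ∏ α ∈ labels b J x, rootS P α

lemma finprod_label_eq (x : Cosets b J) :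
    ∏ᶠ α ∈ {α : ι | ∃ y, Edge b J x α y}, rootS P α = labelProd b J x :=
  finprod_mem_eq_finite_toFinset_prod _ _

lemma labelProd_ne_zero (x : Cosets b J) : labelProd b J x ≠ 0 :=
  Finset.prod_ne_zero_iff.2 fun α _ => rootS_ne_zero α

lemma labelProd_mem_homogeneousS (x : Cosets b J) :
    labelProd b J x ∈ homogeneousS M (rk b J x) :=
  prod_ι_mem_homogeneousS _ _

variable [P.IsCrystallographic] [P.IsReduced]

lemma labelProd_eq {i : b.support} {x : Cosets b J} (h : IsLabel b J x i) :
    actS (weylGroup.ofIdx P (i : ι)) (labelProd b J x) =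
      -(rootS P i * labelProd b J (weylGroup.ofIdx P (i : ι) • x)) := by
  rw [labelProd, ← Finset.mul_prod_erase _ _ (mem_labels.2 h), map_mul, actS_ofIdx_rootS_self,
    labelProd, labels_smul b J h, Finset.prod_map, map_prod, neg_mul]
  simp only [actS_rootS]
  rfl

variable {b J}

lemma labelProd_dvd {q : GKM b J} {x : Cosets b J} (h : ∀ α y, Edge b J x α y → q.1 y = 0) :
    labelProd b J x ∣ q.1 x := by
  refine prod_dvd_of_pairwise _ _ (fun α _ => prime_rootS α) (fun α hα β hβ hne => ?_)
    fun α hα => ?_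
  · exact not_rootS_dvd_rootS b (mem_labels.1 hα).isPos (mem_labels.1 hβ).isPos hne
  · have hE := (mem_labels.1 hα).edge
    have := Ideal.mem_span_singleton.1 (q.2 _ _ _ hE)
    rwa [h _ _ hE, sub_zero] at this

lemma rk_le_of_ne_zero {q : GKM b J} {x : Cosets b J} {d : ℕ} (hq : q.1 x ∈ homogeneousS M d)
    (hx : q.1 x ≠ 0) (h : ∀ α y, Edge b J x α y → q.1 y = 0) : rk b J x ≤ d :=
  card_le_of_prod_ι_dvd _ (fun α => P.root α) (fun α _ => P.ne_zero α) hq hx (labelProd_dvd h)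

variable (b J) in
lemma exists_minimal {S : Cosets b J → Prop} (h : ∃ x, S x) :
    ∃ x, S x ∧ ∀ α y, Edge b J x α y → ¬ S y := by
  obtain ⟨x, hx, hmin⟩ := (measure (minLength b J)).wf.has_min {x | S x} h
  exact ⟨x, hx, fun α y hE hy => hmin y hy hE.minLength_lt⟩

/-- At a minimal vertex of the support, the product of all outgoing labels divides the value. -/
lemma exists_rk_le {q : GKM b J} {d : ℕ} (hq : ∀ x, q.1 x ∈ homogeneousS M d) (h : q ≠ 0) :
    ∃ x, q.1 x ≠ 0 ∧ rk b J x ≤ d := by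
  obtain ⟨x, hx, hmin⟩ := exists_minimal b J (S := fun x => q.1 x ≠ 0) (by
    by_contra! h'
    exact h (Subtype.ext (funext h')))
  exact ⟨x, hx, rk_le_of_ne_zero (hq x) hx fun α y hE => not_not.1 (hmin α y hE)⟩

/-! ### Schubert classes -/

variable (b J) in
/-- The flow-up classes, characterized through the number of outgoing edges: apart from `v`, the
support consists of vertices having more outgoing edges than `v`. -/
structure IsSchubert (v : Cosets b J) (q : GKM b J) : Prop where
  support : ∀ u, q.1 u ≠ 0 → u = v ∨ rk b J v < rk b J u
  homogeneous : ∀ u, q.1 u ∈ homogeneousS M (rk b J v)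
  localization : q.1 v = labelProd b J v

/-- By the degree bound a nonzero difference would be nonzero at v, where both classes agree. -/
lemma IsSchubert.unique {v : Cosets b J} {p q : GKM b J} (hp : IsSchubert b J v p)
    (hq : IsSchubert b J v q) : p = q := by
  by_contra hne
  obtain ⟨x, hx, hrk⟩ := exists_rk_le (q := p - q)
    (fun x => sub_mem (hp.homogeneous x) (hq.homogeneous x)) (sub_ne_zero.2 hne)
  change p.1 x - q.1 x ≠ 0 at hx
  have hxv : x = v := by
    by_cases h : p.1 x = 0
    · have := hq.support x (by rintro h'; simp [h, h'] at hx)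
      lia
    · have := hp.support x h
      lia
  rw [hxv, hp.localization, hq.localization, sub_self] at hx
  exact hx rfl

lemma IsSchubert.leftDiv {v : Cosets b J} {q : GKM b J} (hq : IsSchubert b J v q) {i : b.support}
    (hi : IsLabel b J v i) :
    IsSchubert b J (weylGroup.ofIdx P (i : ι) • v) (leftDiv b J i q) where
  support u hu := by
    have h1 := rk_eq b J hi
    rcases leftDiv_apply_ne_zero hu with h | h
    · rcases hq.support u h with rfl | h'
      · right; lia
      · right; lia
    · rcases hq.support _ h with h' | h'
      · left; rw [← h', ofIdx_smul_smul]
      · have := rk_le b J i (weylGroup.ofIdx P (i : ι) • u)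
        rw [ofIdx_smul_smul] at this
        right; lia
  homogeneous u := by
    by_cases hu : (PartialFlag.leftDiv b J i q).1 u = 0
    · rw [hu]; exact Submodule.zero_mem _
    · obtain ⟨e, he, h⟩ := leftDiv_mem_homogeneousS hq.homogeneous hu
      have h1 := rk_eq b J hi
      have : e = rk b J (weylGroup.ofIdx P (i : ι) • v) := by lia
      rwa [← this]
  localization := by
    have h0 : q.1 (weylGroup.ofIdx P (i : ι) • v) = 0 := by
      by_contra h
      rcases hq.support _ h with h' | h'
      · exact hi.smul_ne h'
      · have := rk_eq b J hi
        lia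
    refine rootS_mul_cancel (P := P) (α := (i : ι)) ?_
    rw [rootS_mul_leftDiv, h0, ofIdx_smul_smul, hq.localization, labelProd_eq b J hi, zero_sub,
      neg_neg]

/-- The support of δ_i q lies where rk ≥ rk(v), while its degree would be rk(v) - 1, against the
degree bound. -/
lemma IsSchubert.leftDiv_eq_zero {v : Cosets b J} {q : GKM b J} (hq : IsSchubert b J v q)
    {i : b.support} (hi : ¬ IsLabel b J v i) : PartialFlag.leftDiv b J i q = 0 := by
  by_contra hne
  have hsupp (u) (hu : (PartialFlag.leftDiv b J i q).1 u ≠ 0) : rk b J v ≤ rk b J u := by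
    rcases leftDiv_apply_ne_zero hu with h | h
    · rcases hq.support u h with rfl | h' <;> lia
    · rcases hq.support _ h with h' | h'
      · by_contra hlt
        refine hi (isLabel_of_rk_lt b J ?_)
        rw [← h', ofIdx_smul_smul, h']
        lia
      · have := rk_le b J i (weylGroup.ofIdx P (i : ι) • u)
        rw [ofIdx_smul_smul] at this
        lia
  obtain ⟨x, hx⟩ : ∃ x, (PartialFlag.leftDiv b J i q).1 x ≠ 0 := by
    by_contra! h'
    exact hne (Subtype.ext (funext h'))
  obtain ⟨e, he, -⟩ := leftDiv_mem_homogeneousS hq.homogeneous hx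
  obtain ⟨u, hu, hle⟩ := exists_rk_le (q := PartialFlag.leftDiv b J i q) (d := e) (fun u => by
    by_cases hu : (PartialFlag.leftDiv b J i q).1 u = 0
    · rw [hu]; exact Submodule.zero_mem _
    · obtain ⟨e', he', h⟩ := leftDiv_mem_homogeneousS hq.homogeneous hu
      have : e' = e := by lia
      rwa [← this]) hne
  have := hsupp u hu
  lia

omit [P.IsCrystallographic] [P.IsReduced] in
/-- A vertex which no edge enters carries a class supported on it alone. -/
lemma single_mem_GKM {v : Cosets b J} (h : ∀ x α, ¬ Edge b J x α v) :
    Pi.single v (labelProd b J v) ∈ GKM b J := by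
  intro x α y hE
  have hy : y ≠ v := by rintro rfl; exact h x α hE
  rw [Pi.single_eq_of_ne hy, sub_zero, Ideal.mem_span_singleton]
  by_cases hx : x = v
  · subst hx
    rw [Pi.single_eq_same]
    exact Finset.dvd_prod_of_mem _ (mem_labels.2 ⟨y, hE⟩)
  · rw [Pi.single_eq_of_ne hx]; exact dvd_zero _

variable (b J) in
lemma exists_isSchubert (v : Cosets b J) : ∃ q, IsSchubert b J v q := by
  generalize hn : Nat.card ι - rk b J v = n
  induction n using Nat.strong_induction_on generalizing v with
  | _ n ih =>
    by_cases h : ∃ i : b.support, IsLabel b J (weylGroup.ofIdx P (i : ι) • v) i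
    -- Here s_i v has larger rk, so its class is available and δ_i brings it down to v.
    · obtain ⟨i, hi⟩ := h
      have h1 := rk_eq b J hi
      rw [ofIdx_smul_smul] at h1
      have h2 := rk_le_card b J (weylGroup.ofIdx P (i : ι) • v)
      obtain ⟨q, hq⟩ := ih (Nat.card ι - rk b J (weylGroup.ofIdx P (i : ι) • v)) (by lia) _ rfl
      have := hq.leftDiv hi
      rw [ofIdx_smul_smul] at this
      exact ⟨_, this⟩
    · push Not at h
      refine ⟨⟨_, single_mem_GKM (v := v) fun x α hE => ?_⟩, ?_, ?_, ?_⟩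
      · obtain ⟨hE, rfl⟩ := (edge_iff b J).1 hE
        refine not_isLabel_smul_of_forall b J h α ?_
        rwa [ofIdx_smul_smul]
      · intro u hu
        by_contra h'
        push Not at h'
        exact hu (Pi.single_eq_of_ne h'.1 _)
      · intro u
        by_cases hu : u = v
        · subst hu
          simp only [Pi.single_eq_same]
          exact labelProd_mem_homogeneousS b J u
        · simp only [Pi.single_eq_of_ne hu]
          exact Submodule.zero_mem _
      · simp

/-! ### The support of Schubert classes -/

/-- At a minimal offending vertex x the class vanishes on all targets of outgoing edges, so rk(x) ≤
rk(v), which forces x = v. -/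
lemma IsSchubert.graphLE {v : Cosets b J} {q : GKM b J} (hq : IsSchubert b J v q) {u : Cosets b J}
    (hu : q.1 u ≠ 0) : GraphLE b J v u := by
  by_contra hv
  obtain ⟨x, ⟨hx, hxv⟩, hmin⟩ := exists_minimal b J
    (S := fun u => q.1 u ≠ 0 ∧ ¬ GraphLE b J v u) ⟨u, hu, hv⟩
  have hle := rk_le_of_ne_zero (hq.homogeneous x) hx fun α y hE => by
    by_contra hy
    exact hmin α y hE ⟨hy, fun h => hxv (h.trans hE.graphLE)⟩
  rcases hq.support x hx with rfl | h
  · exact hxv .refl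
  · lia

omit [Finite ι] [P.IsReduced] in
lemma not_isLabel_one (α : ι) : ¬ IsLabel b J ((1 : P.weylGroup) : Cosets b J) α := by
  rw [isLabel_mk_iff]
  rintro ⟨h, h', -⟩
  simp [h] at h'

/-- Positivity: if no positive root is made negative by both `w⁻¹` and `x`, then the translate by
`x` of the value at `[w]` of a Schubert class is a polynomial in the simple roots whose value at
the point where they are all equal to `1` is a natural number. -/
lemma IsSchubert.evalHeight_eq_natCast (w x : P.weylGroup)
    (hx : ∀ β, b.IsPos β → ¬ b.IsPos (P.weylGroupToPerm w⁻¹ β) → b.IsPos (P.weylGroupToPerm x β))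
    {v : Cosets b J} {q : GKM b J} (hq : IsSchubert b J v q) :
    ∃ n : ℕ, evalHeight b (actS x (q.1 w)) = n ∧ (GraphLE b J v w → n ≠ 0) := by
  generalize hn : length b w = n
  induction n using Nat.strong_induction_on generalizing w x v q with
  | _ n ih =>
    by_cases hw : ∀ i : b.support, b.IsPos (P.weylGroupToPerm w⁻¹ i)
    · obtain rfl := eq_one_of_forall_isPos b hw
      have hempty : labels b J ((1 : P.weylGroup) : Cosets b J) = ∅ := by
        ext α; simpa using not_isLabel_one α
      by_cases hv : ((1 : P.weylGroup) : Cosets b J) = v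
      · subst hv
        refine ⟨1, ?_, by simp⟩
        rw [hq.localization, labelProd, hempty]; simp
      · have h0 : q.1 ((1 : P.weylGroup) : Cosets b J) = 0 := by
          by_contra h
          rcases hq.support _ h with h' | h'
          · exact hv h'
          · simp [rk, hempty] at h'
        refine ⟨0, by rw [h0]; simp, fun h => ?_⟩
        rcases Relation.ReflTransGen.cases_head h with h' | ⟨y, ⟨α, hE⟩, -⟩
        · exact absurd h' hv
        · exact absurd ⟨y, hE⟩ (not_isLabel_one α)
    · push Not at hw
      obtain ⟨i, hi⟩ := hw
      have hlt := length_ofIdx_mul_lt b (isPos_simple b i) hi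
      have hneg : b.IsPos (P.weylGroupToPerm (weylGroup.ofIdx P (i : ι) * w)⁻¹ i) := by
        have e := perm_ofIdx_mul_inv_self w (i : ι)
        rwa [e, isPos_reflectionPerm_self]
      -- The hypothesis on (w, x) passes to (s_i w, x s_i), as s_i w no longer inverts α_i.
      have hx' : ∀ β, b.IsPos β →
          ¬ b.IsPos (P.weylGroupToPerm (weylGroup.ofIdx P (i : ι) * w)⁻¹ β) →
          b.IsPos (P.weylGroupToPerm (x * weylGroup.ofIdx P (i : ι)) β) := by
        intro β hβ hβ'
        have hβi : β ≠ i := by rintro rfl; exact hβ' hneg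
        rw [mul_inv_rev, perm_mul, ofIdx_inv, perm_ofIdx] at hβ'
        rw [perm_mul, perm_ofIdx]
        exact hx _ (isPos_reflectionPerm b hβ i hβi) hβ'
      have hmk : ((weylGroup.ofIdx P (i : ι) * w : P.weylGroup) : Cosets b J) =
        weylGroup.ofIdx P (i : ι) • (w : Cosets b J) := rfl
      have hrec : actS x (q.1 w) =
          actS (x * weylGroup.ofIdx P (i : ι))
              (q.1 ((weylGroup.ofIdx P (i : ι) * w : P.weylGroup) : Cosets b J)) +
            rootS P (P.weylGroupToPerm x i) * actS (x * weylGroup.ofIdx P (i : ι))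
              ((PartialFlag.leftDiv b J i q).1
                ((weylGroup.ofIdx P (i : ι) * w : P.weylGroup) : Cosets b J)) := by
        rw [hmk, leftDiv_smul_apply, actS_mul, actS_mul, actS_ofIdx_ofIdx, ← actS_rootS, ← map_mul,
          ← map_add, rootS_mul_leftDiv, add_sub_cancel]
      -- Since w⁻¹α_i is negative, xα_i is positive, so the factor in the recursion evaluates to a
      -- positive integer.
      obtain ⟨m, hm⟩ : ∃ m : ℕ, b.height (P.weylGroupToPerm x i) = m ∧ m ≠ 0 := by
        have := (b.isPos_iff).1 (hx _ (isPos_simple b i) hi)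
        exact ⟨(b.height (P.weylGroupToPerm x i)).toNat, by lia, by lia⟩
      obtain ⟨n₁, h₁, hn₁⟩ := ih _ (hn ▸ hlt) _ _ hx' hq rfl
      have hlift (h : GraphLE b J v w) :
          GraphLE b J v ((weylGroup.ofIdx P (i : ι) * w : P.weylGroup) : Cosets b J) ∨
          IsLabel b J v i ∧ GraphLE b J (weylGroup.ofIdx P (i : ι) • v)
            ((weylGroup.ofIdx P (i : ι) * w : P.weylGroup) : Cosets b J) := by
        rcases isLabel_trichotomy b J i (w : Cosets b J) with h' | h' | h'
        · exact h.lifting h'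
        · rw [← hmk, isLabel_mk_iff] at h'
          exact absurd hneg h'.2.1
        · left; rwa [hmk, h']
      by_cases hv : IsLabel b J v i
      · obtain ⟨n₂, h₂, hn₂⟩ := ih _ (hn ▸ hlt) _ _ hx' (hq.leftDiv hv) rfl
        refine ⟨n₁ + m * n₂, ?_, fun h => ?_⟩
        · rw [hrec, map_add, map_mul, h₁, h₂, evalHeight_rootS, hm.1]
          push_cast; rfl
        · rcases hlift h with h' | ⟨-, h'⟩
          · have := hn₁ h'
            lia
          · have := Nat.mul_ne_zero hm.2 (hn₂ h')
            lia
      · refine ⟨n₁, ?_, fun h => hn₁ ((hlift h).resolve_right fun h' => hv h'.1)⟩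
        rw [hrec, hq.leftDiv_eq_zero hv, map_add, h₁]
        simp

lemma IsSchubert.apply_ne_zero_iff {v : Cosets b J} {q : GKM b J} (hq : IsSchubert b J v q)
    (u : Cosets b J) : q.1 u ≠ 0 ↔ GraphLE b J v u := by
  refine ⟨hq.graphLE, fun h h0 => ?_⟩
  obtain ⟨w, rfl⟩ := QuotientGroup.mk_surjective u
  obtain ⟨n, hn, hn'⟩ := hq.evalHeight_eq_natCast w 1 (fun β hβ _ => by simpa using hβ)
  rw [h0, map_zero, map_zero] at hn
  exact hn' h (by exact_mod_cast hn.symm)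

/-- Read off from the Schubert class of v: its support contains u, and `IsSchubert` bounds rk there.
-/
lemma GraphLE.eq_or_rk_lt {v u : Cosets b J} (h : GraphLE b J v u) :
    u = v ∨ rk b J v < rk b J u := by
  obtain ⟨q, hq⟩ := exists_isSchubert b J v
  exact hq.support u ((hq.apply_ne_zero_iff u).2 h)

lemma Edge.rk_lt {x y : Cosets b J} {α : ι} (h : Edge b J x α y) : rk b J y < rk b J x :=
  h.graphLE.eq_or_rk_lt.resolve_left h.2.1

lemma isFlowUp_iff_isSchubert {v : Cosets b J} {q : GKM b J} :
    IsFlowUp b J v q ↔ IsSchubert b J v q := by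
  constructor
  · rintro ⟨hsupp, ⟨d, hd⟩, hloc⟩
    rw [finprod_label_eq] at hloc
    have hdv := hd v
    rw [hloc] at hdv
    -- The nonzero value at v fixes the otherwise unspecified degree of a flow-up class.
    have := eq_of_mem_homogeneousS hdv (labelProd_mem_homogeneousS b J v) (labelProd_ne_zero b J v)
    subst this
    exact ⟨fun u hu => ((hsupp u).1 hu).eq_or_rk_lt, hd, hloc⟩
  · intro h
    exact ⟨h.apply_ne_zero_iff, ⟨_, h.homogeneous⟩, by rw [finprod_label_eq, h.localization]⟩

/-! ### The basis of Schubert classes -/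

lemma linearIndependent_of_isSchubert {p : Cosets b J → GKM b J}
    (hp : ∀ v, IsSchubert b J v (p v)) : LinearIndependent (SymmetricAlgebra ℂ M) p := by
  have := finite_weylGroup b
  have := Fintype.ofFinite (Cosets b J)
  rw [Fintype.linearIndependent_iff]
  intro g hg
  by_contra! h
  -- Evaluated at a v of least rk with nonzero coefficient, every other term vanishes.
  obtain ⟨v, hv, hmin⟩ := (measure (rk b J)).wf.has_min {v | g v ≠ 0} h
  have h1 : ∑ u, g u * (p u).1 v = 0 := by
    have := congrArg (fun q : GKM b J => q.1 v) hg
    simpa [Finset.sum_apply] using this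
  rw [Finset.sum_eq_single v, (hp v).localization] at h1
  · exact mul_ne_zero hv (labelProd_ne_zero b J v) h1
  · intro u _ hu
    by_contra h2
    rcases (hp u).support v (right_ne_zero_of_mul h2) with h' | h'
    · exact hu h'.symm
    · exact hmin u (left_ne_zero_of_mul h2) h'
  · simp

lemma span_eq_top_of_isSchubert {p : Cosets b J → GKM b J} (hp : ∀ v, IsSchubert b J v (p v)) :
    Submodule.span (SymmetricAlgebra ℂ M) (Set.range p) = ⊤ := by
  have := finite_weylGroup b
  have := Fintype.ofFinite (Cosets b J)
  -- Here q vanishes below rank k, and n bounds the ranks left to clear; no rank exceeds the number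
  -- of roots.
  have key (n k : ℕ) (hk : Nat.card ι < k + n) (q : GKM b J)
      (hq : ∀ x, rk b J x < k → q.1 x = 0) :
      q ∈ Submodule.span (SymmetricAlgebra ℂ M) (Set.range p) := by
    induction n generalizing k q with
    | zero =>
      have : q = 0 := Subtype.ext <| funext fun x =>
        hq x ((rk_le_card b J x).trans_lt (by simpa using hk))
      rw [this]; exact Submodule.zero_mem _
    | succ n ih =>
      have hdvd (x : Cosets b J) : ∃ c, rk b J x = k → q.1 x = labelProd b J x * c := by
        by_cases hx : rk b J x = k
        · obtain ⟨c, hc⟩ := labelProd_dvd (q := q) (x := x)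
            fun α y hE => hq y (hx ▸ hE.rk_lt)
          exact ⟨c, fun _ => hc⟩
        · exact ⟨0, fun h => absurd h hx⟩
      choose c hc using hdvd
      -- At rank k distinct Schubert classes do not interfere, so r matches q there and q - r
      -- vanishes one rank further.
      set r : GKM b J := ∑ u, (if rk b J u = k then c u else 0) • p u with hr
      have hrspan : r ∈ Submodule.span (SymmetricAlgebra ℂ M) (Set.range p) :=
        Submodule.sum_mem _ fun u _ => Submodule.smul_mem _ _ (Submodule.subset_span ⟨u, rfl⟩)
      have hrx (x : Cosets b J) (hx : rk b J x < k + 1) :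
          r.1 x = if rk b J x = k then c x * labelProd b J x else 0 := by
        have e : r.1 x = ∑ u, (if rk b J u = k then c u else 0) * (p u).1 x := by
          simp [hr, Finset.sum_apply, -ite_smul]
        rw [e, Finset.sum_eq_single x, (hp x).localization, ite_mul, zero_mul]
        · intro u _ hu
          by_contra h2
          have h3 : rk b J u = k := by
            by_contra h3; exact left_ne_zero_of_mul h2 (if_neg h3)
          rcases (hp u).support x (right_ne_zero_of_mul h2) with h' | h'
          · exact hu h'.symm
          · lia
        · simp
      rw [← sub_add_cancel q r]
      refine Submodule.add_mem _ (ih (k + 1) (by lia) _ fun x hx => ?_) hrspan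
      change q.1 x - r.1 x = 0
      rw [hrx x hx]
      split_ifs with h
      · rw [hc x h]; ring
      · rw [hq x (by lia), sub_zero]
  exact Submodule.eq_top_iff'.2 fun q => key (Nat.card ι + 1) 0 (by lia) q (by simp)

end PartialFlag

end

theorem proposition4 {ι M N : Type*} [Finite ι]
    [AddCommGroup M] [Module ℂ M] [AddCommGroup N] [Module ℂ N]
    (P : RootPairing ι ℂ M N) [P.IsCrystallographic] [P.IsReduced]
    (b : P.Base) (J : Set b.support) :
    -- the flow-up classes exist, are unique, and form a basis
    ∃ p : PartialFlag.Cosets b J → PartialFlag.GKM b J,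
      (∀ v q, PartialFlag.IsFlowUp b J v q ↔ q = p v) ∧
      LinearIndependent (SymmetricAlgebra ℂ M) p ∧
      Submodule.span (SymmetricAlgebra ℂ M) (Set.range p) = ⊤ ∧
      ∀ i : b.support,
        let s : P.weylGroup := RootPairing.weylGroup.ofIdx P (i : ι)
        let a : SymmetricAlgebra ℂ M := PartialFlag.rootS P (i : ι)
        -- a quotient by the simple root is unique when it exists
        (∀ f g : SymmetricAlgebra ℂ M, a * f = a * g → f = g) ∧
        -- the operators `∂ f = (f - s f) / a` and `δ q = (q - s · q) / a` are well defined
        ∃ (D : SymmetricAlgebra ℂ M →ₗ[ℂ] SymmetricAlgebra ℂ M)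
          (δ : PartialFlag.GKM b J →ₗ[ℂ] PartialFlag.GKM b J),
          (∀ f, a * D f = f - PartialFlag.actS s f) ∧
          (∀ q x, a * (δ q).1 x = q.1 x - PartialFlag.actFun s q.1 x) ∧
          (∀ q, δ (δ q) = 0) ∧
          (∀ (c : SymmetricAlgebra ℂ M) (q : PartialFlag.GKM b J),
            δ (c • q) = D c • q + PartialFlag.actS s c • δ q) ∧
          (∀ v, PartialFlag.CosetLT b J (s • v) v → δ (p v) = p (s • v)) ∧
          (∀ v, ¬ PartialFlag.CosetLT b J (s • v) v → δ (p v) = 0) := by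
  choose p hp using PartialFlag.exists_isSchubert b J
  refine ⟨p, fun v q => ?_, PartialFlag.linearIndependent_of_isSchubert hp,
    PartialFlag.span_eq_top_of_isSchubert hp, fun i => ⟨fun f g => PartialFlag.rootS_mul_cancel,
      PartialFlag.divDiff P i, PartialFlag.leftDiv b J i, PartialFlag.rootS_mul_divDiff _,
      fun q x => ?_, PartialFlag.leftDiv_leftDiv i, PartialFlag.leftDiv_smul i,
      fun v hv => ?_, fun v hv => ?_⟩⟩
  · rw [PartialFlag.isFlowUp_iff_isSchubert]
    exact ⟨fun h => h.unique (hp v), fun h => h ▸ hp v⟩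
  · rw [PartialFlag.rootS_mul_leftDiv, PartialFlag.actFun_ofIdx]
  · rw [PartialFlag.cosetLT_smul_iff] at hv
    exact ((hp v).leftDiv hv).unique (hp _)
  · rw [PartialFlag.cosetLT_smul_iff] at hv
    exact (hp v).leftDiv_eq_zero hv
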